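/- \textbf{Conventions.} $\mathcal H^t$ denotes $t$-dimensional Hausdorff measure on $\mathbb R$ and $B(y,r)=(y-r,y+r)$. For an open set $\Omega\subset\mathbb R^2$ and $1\le p\le\infty$, $W^{1,p}(\Omega)$ is the set of $f\in L^p(\Omega)$ whose weak first order partial derivatives exist and belong to $L^p(\Omega)$. A closed set $E\subset\mathbb R^2$ is called \emph{$p$-removable} if it has Lebesgue measure zero and $W^{1,p}(\mathbb R^2\setminus E)=W^{1,p}(\mathbb R^2)$ as sets of functions (functions on $\mathbb R^2\setminus E$ being identified with their extensions to $\mathbb R^2$, which are determined up to a null set). \textbf{Theorem.} Let $2\le p<\infty$ and $s<\frac{p-2}{p-1}$. Suppose that $C\subset\mathbb R$ is a closed set with $\mathcal H^s(C)<\infty$ and that $F\subset\mathbb R$ is a closed set such that for $\mathcal H^1$-almost every $y\in F$ there exist $r_y>0$ and $c_y>0$ with $$\mathcal H^1\bigl(B(y,r)\setminus F\bigr)\ \ge\ c_y\, r^{(1-s)(p-1)}\qquad\text{for all } 0<r<r_y .$$ Then the set $C\times F$ is $p$-removable; that is, $C\times F$ has Lebesgue measure zero and $W^{1,p}(\mathbb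 R^2\setminus(C\times F))=W^{1,p}(\mathbb R^2)$. -/

import Mathlib

open MeasureTheory Set
open scoped ENNReal ContDiff

/-- `g` is a weak derivative of `f` in the direction `v` on the open set `Ω` of the plane: for every
smooth real function `φ` with compact support contained in `Ω`, `∫_Ω f ∂_v φ = - ∫_Ω g φ`. -/
def HasWeakDirDeriv (Ω : Set (ℝ × ℝ)) (v : ℝ × ℝ) (f g : ℝ × ℝ → ℝ) : Prop :=
  ∀ φ : ℝ × ℝ → ℝ, ContDiff ℝ ∞ φ → HasCompactSupport φ → tsupport φ ⊆ Ω →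
    ∫ z in Ω, f z * fderiv ℝ φ z v = - ∫ z in Ω, g z * φ z

/-- The Sobolev space `W^{1,p}(Ω)`: the functions in `L^p(Ω)` whose weak first order partial
derivatives exist on `Ω` and are in `L^p(Ω)`. A function on `Ω` is represented by a function on the
whole plane; its values outside `Ω` play no role in the membership. -/
def sobolevSpace (p : ℝ≥0∞) (Ω : Set (ℝ × ℝ)) : Set (ℝ × ℝ → ℝ) :=
  {f | MemLp f p (volume.restrict Ω) ∧
    (∃ g : ℝ × ℝ → ℝ, MemLp g p (volume.restrict Ω) ∧ HasWeakDirDeriv Ω (1, 0) f g) ∧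
    (∃ g : ℝ × ℝ → ℝ, MemLp g p (volume.restrict Ω) ∧ HasWeakDirDeriv Ω (0, 1) f g)}

/-- A set `E` in the plane is `p`-removable if it has Lebesgue measure zero and
`W^{1,p}(ℝ² \ E) = W^{1,p}(ℝ²)` as sets. Since `E` is a null set, a function on `ℝ² \ E` and any of
its extensions to the plane are the same up to a null set. -/
def IsSobolevRemovable (p : ℝ≥0∞) (E : Set (ℝ × ℝ)) : Prop :=
  volume E = 0 ∧ sobolevSpace p Eᶜ = sobolevSpace p univ

/-!
The set `E = C × F` is null because `C` is, and almost every vertical line misses it, so weak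
vertical derivatives extend across `E` for free
(`HasWeakDirDeriv.vertical_univ_of_null`). The point is the horizontal derivative. For
`f ∈ W^{1,p}(ℝ² \ E)` with weak derivatives `g` (horizontal) and `h` (vertical), it is tested line
by line: for a test function `ψ` of one variable, one shows that
`Λ_y(ψ) = ∫ f(x, y) ψ'(x) + g(x, y) ψ(x) dx` vanishes for almost every height `y`
(`hasWeakDirDeriv_horizontal_of_slicePair`). If `y ∉ F`, or if the support of `ψ` misses `C`, this
holds because no singularity is met (`ae_slicePair_deriv_add_slicePair_eq_zero`).

For `y ∈ F`, the finite Hausdorff measure gives covers of `C` near the support of `ψ` by balls of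
radii `2⁻ᵐ`, `m ≥ k`, with `∑ (radius)^s` bounded. Grouping the balls by scale, `ψ` is a sum of
functions `u m` of scale `2⁻ᵐ`, supported in sets `T m` with `∑ 2^{m(1-s)} |T m|` bounded, and a
remainder supported off `C` (`exists_multiscale_decomposition`). So `Λ_y(ψ) = ∑ Λ_y(u m)`. Here
`∑ ∫ g(x, y) u m (x) dx` is small because the `T m` are, and `∫ f(x, y) (u m)'(x) dx` is compared
with the same integral at the heights `t` in the gap `G = B(y, 2⁻ᵐ) \ F`
(`ae_enorm_slicePair_deriv_mul_le`):
* the difference between the heights `y` and `t` is an integral of `h` over a part of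
  `T m × B(y, 2⁻ᵐ)`, and Hölder's inequality bounds it by a term of a geometric series, precisely
  because `s < (p - 2) / (p - 1)` (`vertical_term_le`);
* at height `t` it equals `-∫ g(x, t) u m (x) dx`, and the average of this over `G` is bounded by
  Hölder's inequality; the lower bound on the measure of `G` is such that the powers of `2ᵐ` cancel
  (`horizontal_term_le`), and a discrete Hölder inequality over `m` leaves the `L^p` norm of `g`
  on the strip of height `2⁻ᵏ` around the line (`sum_horizontal_le`).

Letting `k → ∞` gives `Λ_y(ψ) = 0`.
-/

/-! ### Weak derivatives on the line -/

/-- A smooth compactly supported function with vanishing integral is the derivative of a smooth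
compactly supported function. -/
theorem exists_contDiff_deriv_eq_of_integral_eq_zero {η : ℝ → ℝ} (hη : ContDiff ℝ ∞ η)
    (hηc : HasCompactSupport η) (h0 : ∫ x, η x = 0) :
    ∃ κ : ℝ → ℝ, ContDiff ℝ ∞ κ ∧ HasCompactSupport κ ∧ deriv κ = η := by
  obtain ⟨R, hR⟩ := hηc.isCompact.isBounded.subset_closedBall 0
  have hout : ∀ x, R < |x| → η x = 0 := fun x hx => by
    by_contra hne
    have := hR (subset_tsupport η hne)
    simp at this
    linarith
  have hder : ∀ x, HasDerivAt (fun x => ∫ t in (-(|R| + 1))..x, η t) (η x) x := fun x =>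
    intervalIntegral.integral_hasDerivAt_right (hη.continuous.intervalIntegrable _ _)
      (hη.continuous.stronglyMeasurableAtFilter _ _) hη.continuous.continuousAt
  have hd : deriv (fun x => ∫ t in (-(|R| + 1))..x, η t) = η := funext fun x => (hder x).deriv
  refine ⟨fun x => ∫ t in (-(|R| + 1))..x, η t, ?_, ?_, hd⟩
  · rw [contDiff_infty_iff_deriv, hd]
    exact ⟨fun x => (hder x).differentiableAt, hη⟩
  · refine HasCompactSupport.intro (isCompact_Icc (a := -(|R| + 1)) (b := |R| + 1)) fun x hx => ?_
    have hRa := le_abs_self R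
    rw [mem_Icc, not_and_or, not_le, not_le] at hx
    rcases hx with hx | hx
    · have : ∀ t ∈ uIcc (-(|R| + 1)) x, η t = 0 := fun t ht => hout t <| by
        rw [uIcc_of_ge hx.le] at ht
        rw [lt_abs]; right; linarith [ht.2]
      rw [intervalIntegral.integral_congr this]
      simp
    · rw [← h0]
      refine intervalIntegral.integral_eq_integral_of_support_subset fun t ht => ?_
      by_contra hc
      refine ht (hout t ?_)
      rw [mem_Ioc, not_and_or, not_lt, not_le] at hc
      rw [lt_abs]
      rcases hc with hc | hc
      · right; linarith
      · left; linarith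

/-- **Du Bois-Reymond lemma**: a locally integrable function on the line whose weak derivative
vanishes is almost everywhere constant. -/
theorem ae_eq_const_of_integral_mul_deriv_eq_zero {D : ℝ → ℝ} (hD : LocallyIntegrable D)
    (h : ∀ θ : ℝ → ℝ, ContDiff ℝ ∞ θ → HasCompactSupport θ → ∫ y, D y * deriv θ y = 0) :
    ∃ c : ℝ, ∀ᵐ y, D y = c := by
  let b : ContDiffBump (0 : ℝ) := ⟨1, 2, one_pos, one_lt_two⟩
  set θ₀ : ℝ → ℝ := b.normed volume
  have hθ₀ : ContDiff ℝ ∞ θ₀ := b.contDiff_normed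
  have hθ₀c : HasCompactSupport θ₀ := b.hasCompactSupport_normed
  have hθ₀1 : ∫ y, θ₀ y = 1 := b.integral_normed
  have hint : ∀ θ : ℝ → ℝ, ContDiff ℝ ∞ θ → HasCompactSupport θ →
      Integrable fun y => D y * θ y := fun θ hθ hθc =>
    hD.integrable_smul_right_of_hasCompactSupport hθ.continuous hθc
  refine ⟨∫ y, D y * θ₀ y, ?_⟩
  set c := ∫ y, D y * θ₀ y
  have key := ae_eq_zero_of_integral_contDiff_smul_eq_zero
    (hD.sub (locallyIntegrable_const c)) (fun θ hθ hθc => ?_)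
  · filter_upwards [key] with y hy
    simpa [sub_eq_zero] using hy
  · have hθi : Integrable θ := hθ.continuous.integrable_of_hasCompactSupport hθc
    have hθ₀i : Integrable θ₀ := hθ₀.continuous.integrable_of_hasCompactSupport hθ₀c
    obtain ⟨κ, hκ, hκc, hκd⟩ := exists_contDiff_deriv_eq_of_integral_eq_zero
      (η := fun y => θ y - (∫ y, θ y) * θ₀ y) (hθ.sub (contDiff_const.mul hθ₀))
      (hθc.sub hθ₀c.mul_left)
      (by rw [integral_sub hθi (hθ₀i.const_mul _), integral_const_mul, hθ₀1]; ring)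
    have h1 := h κ hκ hκc
    rw [hκd] at h1
    have h2 : ∫ y, D y * (θ y - (∫ y, θ y) * θ₀ y)
        = (∫ y, D y * θ y) - (∫ y, θ y) * c := by
      rw [← integral_const_mul, ← integral_sub (hint θ hθ hθc) ((hint θ₀ hθ₀ hθ₀c).const_mul _)]
      congr 1; ext y; ring
    have h3 : ∫ y, θ y • (D y - c) = (∫ y, D y * θ y) - (∫ y, θ y) * c := by
      rw [← integral_mul_const, ← integral_sub (hint θ hθ hθc) (hθi.mul_const _)]
      congr 1; ext y; simp only [smul_eq_mul]; ring
    exact h3.trans (h2.symm.trans h1)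

/-- A locally integrable function on the line with a locally integrable weak derivative is almost
everywhere a primitive of it. -/
theorem exists_ae_eq_const_add_intervalIntegral {A B : ℝ → ℝ} (hA : LocallyIntegrable A)
    (hB : LocallyIntegrable B)
    (h : ∀ θ : ℝ → ℝ, ContDiff ℝ ∞ θ → HasCompactSupport θ →
      ∫ y, A y * deriv θ y = - ∫ y, B y * θ y) :
    ∃ c : ℝ, ∀ᵐ y, A y = c + ∫ t in (0 : ℝ)..y, B t := by
  have hBi : ∀ a b, IntervalIntegrable B volume a b := fun a b =>
    (hB.integrableOn_isCompact isCompact_uIcc).intervalIntegrable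
  set P : ℝ → ℝ := fun y => ∫ t in (0 : ℝ)..y, B t
  have hPc : Continuous P := intervalIntegral.continuous_primitive hBi 0
  suffices hD : ∀ θ : ℝ → ℝ, ContDiff ℝ ∞ θ → HasCompactSupport θ →
      ∫ y, (A - P) y * deriv θ y = 0 by
    obtain ⟨c, hc⟩ := ae_eq_const_of_integral_mul_deriv_eq_zero (hA.sub hPc.locallyIntegrable) hD
    refine ⟨c, ?_⟩
    filter_upwards [hc] with y hy
    rw [← hy, Pi.sub_apply, sub_add_cancel]
  intro θ hθ hθc
  have hdc : HasCompactSupport (deriv θ) := hθc.deriv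
  have hdcont : Continuous (deriv θ) := hθ.continuous_deriv (by simp)
  obtain ⟨R, hR0, hR⟩ : ∃ R > 0, tsupport θ ⊆ Ioo (-R) R := by
    obtain ⟨R, hR⟩ := hθc.isCompact.isBounded.subset_closedBall 0
    refine ⟨|R| + 1, by positivity, fun x hx => ?_⟩
    have := hR hx
    rw [mem_closedBall_zero_iff, Real.norm_eq_abs] at this
    rw [mem_Ioo, ← abs_lt]
    linarith [le_abs_self R]
  have hPac : AbsolutelyContinuousOnInterval P (-R) R :=
    (hBi _ _).absolutelyContinuousOnInterval_intervalIntegral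
      (by rw [uIcc_of_le (by linarith)]; constructor <;> linarith)
  have hθac : AbsolutelyContinuousOnInterval θ (-R) R :=
    (hθ.of_le (by simp)).contDiffOn.absolutelyContinuousOnInterval
  have hbd : ∀ x, x ∉ Ioo (-R) R → θ x = 0 := fun x hx =>
    image_eq_zero_of_notMem_tsupport fun hx' => hx (hR hx')
  have key := hPac.integral_mul_deriv_eq_deriv_mul hθac
  rw [hbd R (by simp), hbd (-R) (by simp), mul_zero, mul_zero, sub_zero, zero_sub] at key
  have e1 : ∫ y, P y * deriv θ y = ∫ y in (-R)..R, P y * deriv θ y := by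
    refine (intervalIntegral.integral_eq_integral_of_support_subset fun x hx => ?_).symm
    exact Ioo_subset_Ioc_self (hR (support_deriv_subset (right_ne_zero_of_mul hx)))
  have e2 : ∫ y, B y * θ y = ∫ y in (-R)..R, deriv P y * θ y := by
    rw [← intervalIntegral.integral_eq_integral_of_support_subset (a := -R) (b := R)
      (f := fun y => B y * θ y) fun x hx =>
        Ioo_subset_Ioc_self (hR (subset_tsupport _ (right_ne_zero_of_mul hx)))]
    refine intervalIntegral.integral_congr_ae ?_
    filter_upwards [_root_.LocallyIntegrable.ae_hasDerivAt_integral hB] with x hx _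
    rw [(hx 0).deriv]
  have i1 : Integrable fun y => A y * deriv θ y :=
    hA.integrable_smul_right_of_hasCompactSupport hdcont hdc
  have i2 : Integrable fun y => P y * deriv θ y :=
    hPc.locallyIntegrable.integrable_smul_right_of_hasCompactSupport hdcont hdc
  simp only [Pi.sub_apply, sub_mul]
  rw [integral_sub i1 i2, h θ hθ hθc, e1, e2, key, sub_self]

/-! ### Horizontal slices of functions on the plane -/

/-- The pairing `∫ f(x, y) a(x) dx` of the restriction of `f` to the horizontal line at height `y`
with a function `a` of one variable. -/
noncomputable def slicePair (f : ℝ × ℝ → ℝ) (a : ℝ → ℝ) (y : ℝ) : ℝ := ∫ x, f (x, y) * a x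

theorem hasCompactSupport_mul_prod {a b : ℝ → ℝ} (ha : HasCompactSupport a)
    (hb : HasCompactSupport b) : HasCompactSupport fun z : ℝ × ℝ => a z.1 * b z.2 := by
  refine HasCompactSupport.intro (ha.isCompact.prod hb.isCompact) fun z hz => ?_
  rw [mem_prod, not_and_or] at hz
  rcases hz with hz | hz <;> simp [image_eq_zero_of_notMem_tsupport hz]

theorem tsupport_mul_prod_subset (a b : ℝ → ℝ) :
    tsupport (fun z : ℝ × ℝ => a z.1 * b z.2) ⊆ tsupport a ×ˢ tsupport b := by
  refine closure_minimal (fun z hz => ?_) ((isClosed_tsupport a).prod (isClosed_tsupport b))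
  exact ⟨subset_tsupport _ (left_ne_zero_of_mul hz), subset_tsupport _ (right_ne_zero_of_mul hz)⟩

theorem fderiv_mul_prod {a b : ℝ → ℝ} (ha : ContDiff ℝ ∞ a) (hb : ContDiff ℝ ∞ b)
    (z v : ℝ × ℝ) :
    fderiv ℝ (fun z : ℝ × ℝ => a z.1 * b z.2) z v
      = deriv a z.1 * v.1 * b z.2 + a z.1 * (deriv b z.2 * v.2) := by
  have h1 : HasFDerivAt (fun z : ℝ × ℝ => a z.1) _ z :=
    ((ha.differentiable (by simp)) z.1).hasDerivAt.hasFDerivAt.comp z hasFDerivAt_fst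
  have h2 : HasFDerivAt (fun z : ℝ × ℝ => b z.2) _ z :=
    ((hb.differentiable (by simp)) z.2).hasDerivAt.hasFDerivAt.comp z hasFDerivAt_snd
  rw [(h1.fun_mul h2).fderiv]
  simp
  ring

section
variable {f g : ℝ × ℝ → ℝ}

theorem integrable_mul_prod (hf : LocallyIntegrable f) {a b : ℝ → ℝ} (ha : Continuous a)
    (hac : HasCompactSupport a) (hb : Continuous b) (hbc : HasCompactSupport b) :
    Integrable fun z : ℝ × ℝ => f z * (a z.1 * b z.2) :=
  hf.integrable_smul_right_of_hasCompactSupport (by fun_prop) (hasCompactSupport_mul_prod hac hbc)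

theorem slicePair_mul (f : ℝ × ℝ → ℝ) (a b : ℝ → ℝ) (y : ℝ) :
    slicePair f a y * b y = ∫ x, f (x, y) * (a x * b y) := by
  rw [slicePair, ← integral_mul_const]
  simp_rw [mul_assoc]

theorem integrable_slicePair_mul (hf : LocallyIntegrable f) {a b : ℝ → ℝ} (ha : Continuous a)
    (hac : HasCompactSupport a) (hb : Continuous b) (hbc : HasCompactSupport b) :
    Integrable fun y => slicePair f a y * b y := by
  simp_rw [slicePair_mul]
  exact (integrable_mul_prod hf ha hac hb hbc).integral_prod_right

/-- Fubini's theorem for products of a locally integrable function and a test function with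
separated variables. -/
theorem integral_slicePair_mul (hf : LocallyIntegrable f) {a b : ℝ → ℝ} (ha : Continuous a)
    (hac : HasCompactSupport a) (hb : Continuous b) (hbc : HasCompactSupport b) :
    ∫ y, slicePair f a y * b y = ∫ z : ℝ × ℝ, f z * (a z.1 * b z.2) := by
  simp_rw [slicePair_mul]
  exact (integral_prod_symm _ (integrable_mul_prod hf ha hac hb hbc)).symm

theorem locallyIntegrable_slicePair (hf : LocallyIntegrable f) {a : ℝ → ℝ} (ha : Continuous a)
    (hac : HasCompactSupport a) : LocallyIntegrable (slicePair f a) := by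
  intro y
  let b : ContDiffBump y := ⟨1, 2, one_pos, one_lt_two⟩
  refine ⟨Metric.closedBall y 1, Metric.closedBall_mem_nhds y one_pos, ?_⟩
  refine ((integrable_slicePair_mul hf ha hac b.continuous b.hasCompactSupport).integrableOn
    (s := Metric.closedBall y 1)).congr_fun (fun t ht => ?_) measurableSet_closedBall
  simp [b.one_of_mem_closedBall ht]

/-- If the product of the support of a test function `a` with an open set `U` lies in `Ω`, then on
almost every horizontal line at a height in `U`, the slice of a weak horizontal derivative on `Ω`
is the derivative of the slice, as far as pairing with `a` is concerned. -/
theorem ae_slicePair_deriv_add_slicePair_eq_zero (hf : LocallyIntegrable f)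
    (hg : LocallyIntegrable g) {Ω : Set (ℝ × ℝ)} (hw : HasWeakDirDeriv Ω (1, 0) f g)
    {a : ℝ → ℝ} (ha : ContDiff ℝ ∞ a) (hac : HasCompactSupport a) {U : Set ℝ} (hU : IsOpen U)
    (hsub : tsupport a ×ˢ U ⊆ Ω) :
    ∀ᵐ y, y ∈ U → slicePair f (deriv a) y + slicePair g a y = 0 := by
  have ha' : Continuous (deriv a) := ha.continuous_deriv (by simp)
  have l1 := locallyIntegrable_slicePair hf ha' hac.deriv
  have l2 := locallyIntegrable_slicePair hg ha.continuous hac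
  refine hU.ae_eq_zero_of_integral_contDiff_smul_eq_zero
    ((l1.add l2).locallyIntegrableOn U) fun b hb hbc hbU => ?_
  have hsupp : tsupport (fun z : ℝ × ℝ => a z.1 * b z.2) ⊆ Ω :=
    (tsupport_mul_prod_subset a b).trans ((prod_mono_right hbU).trans hsub)
  have hz : ∀ z ∉ Ω, a z.1 * b z.2 = 0 := fun z hz =>
    image_eq_zero_of_notMem_tsupport (f := fun z : ℝ × ℝ => a z.1 * b z.2)
      fun h => hz (hsupp h)
  have hz' : ∀ z ∉ Ω, deriv a z.1 * b z.2 = 0 := fun z hz => by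
    by_contra hne
    exact hz (hsub ⟨support_deriv_subset (left_ne_zero_of_mul hne),
      hbU (subset_tsupport _ (right_ne_zero_of_mul hne))⟩)
  have key := hw (fun z => a z.1 * b z.2) (by fun_prop) (hasCompactSupport_mul_prod hac hbc) hsupp
  simp only [fderiv_mul_prod ha hb, mul_one, mul_zero, add_zero] at key
  rw [setIntegral_eq_integral_of_forall_compl_eq_zero (fun z hzΩ => by rw [hz' z hzΩ, mul_zero]),
    setIntegral_eq_integral_of_forall_compl_eq_zero (fun z hzΩ => by rw [hz z hzΩ, mul_zero]),
    ← integral_slicePair_mul hf ha' hac.deriv hb.continuous hbc,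
    ← integral_slicePair_mul hg ha.continuous hac hb.continuous hbc] at key
  simp only [smul_eq_mul, mul_comm (b _), add_mul]
  rw [integral_add (integrable_slicePair_mul hf ha' hac.deriv hb.continuous hbc)
    (integrable_slicePair_mul hg ha.continuous hac hb.continuous hbc), key, neg_add_cancel]

/-- Pairings with horizontal slices are absolutely continuous in the height, up to a null set, if
the function has a weak vertical derivative. -/
theorem exists_ae_slicePair_eq_add_intervalIntegral (hf : LocallyIntegrable f)
    (hg : LocallyIntegrable g) (hw : HasWeakDirDeriv univ (0, 1) f g)
    {a : ℝ → ℝ} (ha : ContDiff ℝ ∞ a) (hac : HasCompactSupport a) :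
    ∃ c : ℝ, ∀ᵐ y, slicePair f a y = c + ∫ t in (0 : ℝ)..y, slicePair g a t := by
  refine exists_ae_eq_const_add_intervalIntegral
    (locallyIntegrable_slicePair hf ha.continuous hac)
    (locallyIntegrable_slicePair hg ha.continuous hac) fun b hb hbc => ?_
  have key := hw (fun z => a z.1 * b z.2) (by fun_prop) (hasCompactSupport_mul_prod hac hbc)
    (subset_univ _)
  simp only [fderiv_mul_prod ha hb, mul_one, mul_zero, zero_mul, zero_add,
    Measure.restrict_univ] at key
  rwa [integral_slicePair_mul hf ha.continuous hac (hb.continuous_deriv (by simp)) hbc.deriv,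
    integral_slicePair_mul hg ha.continuous hac hb.continuous hbc]

theorem continuous_fderiv_apply_of_contDiff {φ : ℝ × ℝ → ℝ} (hφ : ContDiff ℝ ∞ φ) (v : ℝ × ℝ) :
    Continuous fun z => fderiv ℝ φ z v :=
  (hφ.continuous_fderiv (by simp)).clm_apply continuous_const

/-- A weak vertical derivative on the complement of `C × F` is a weak vertical derivative on the
plane if `C` is closed and null: almost every vertical line misses `C × F`. -/
theorem HasWeakDirDeriv.vertical_univ_of_null (hf : LocallyIntegrable f)
    (hg : LocallyIntegrable g) {C F : Set ℝ} (hC : IsClosed C) (hC0 : volume C = 0)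
    (hE0 : volume (C ×ˢ F) = 0)
    (hw : HasWeakDirDeriv (C ×ˢ F)ᶜ (0, 1) f g) : HasWeakDirDeriv univ (0, 1) f g := by
  intro φ hφ hφc _
  have hres : (volume : Measure (ℝ × ℝ)).restrict (C ×ˢ F)ᶜ = volume :=
    Measure.restrict_eq_self_of_ae_mem (compl_mem_ae_iff.2 hE0)
  have hdc : HasCompactSupport fun z => fderiv ℝ φ z (0, 1) := hφc.fderiv_apply ℝ (0, 1)
  have hdcont := continuous_fderiv_apply_of_contDiff hφ (0, 1)
  have i1 : Integrable fun z => f z * fderiv ℝ φ z (0, 1) :=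
    hf.integrable_smul_right_of_hasCompactSupport hdcont hdc
  have i2 : Integrable fun z => g z * φ z :=
    hg.integrable_smul_right_of_hasCompactSupport hφ.continuous hφc
  have i3 : Integrable fun z => f z * fderiv ℝ φ z (0, 1) + g z * φ z := i1.add i2
  have hzero : ∀ᵐ x, x ∈ Cᶜ →
      ∫ y, (f (x, y) * fderiv ℝ φ (x, y) (0, 1) + g (x, y) * φ (x, y)) = 0 := by
    refine hC.isOpen_compl.ae_eq_zero_of_integral_contDiff_smul_eq_zero
      (i3.integral_prod_left.locallyIntegrable.locallyIntegrableOn _) fun η hη hηc hηC => ?_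
    have hsupp : tsupport (fun z : ℝ × ℝ => η z.1 * φ z) ⊆ (C ×ˢ F)ᶜ := by
      have : tsupport (fun z : ℝ × ℝ => η z.1 * φ z) ⊆ Prod.fst ⁻¹' tsupport η :=
        closure_minimal (fun z hz => subset_tsupport _ (left_ne_zero_of_mul hz))
          ((isClosed_tsupport η).preimage continuous_fst)
      exact fun z hz hzE => hηC (this hz) hzE.1
    have hηφ : ContDiff ℝ ∞ fun z : ℝ × ℝ => η z.1 * φ z := by fun_prop
    have key := hw (fun z => η z.1 * φ z) hηφ hφc.mul_left hsupp
    have hder : ∀ z : ℝ × ℝ, fderiv ℝ (fun z : ℝ × ℝ => η z.1 * φ z) z (0, 1)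
        = η z.1 * fderiv ℝ φ z (0, 1) := fun z => by
      have h1 : HasFDerivAt (fun z : ℝ × ℝ => η z.1) _ z :=
        ((hη.differentiable (by simp)) z.1).hasDerivAt.hasFDerivAt.comp z hasFDerivAt_fst
      rw [(h1.fun_mul ((hφ.differentiable (by simp)) z).hasFDerivAt).fderiv]
      simp
    simp only [hder, hres] at key
    have j1 : Integrable fun z : ℝ × ℝ => f z * (η z.1 * fderiv ℝ φ z (0, 1)) :=
      hf.integrable_smul_right_of_hasCompactSupport (by fun_prop) hdc.mul_left
    have j2 : Integrable fun z : ℝ × ℝ => g z * (η z.1 * φ z) :=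
      hg.integrable_smul_right_of_hasCompactSupport hηφ.continuous hφc.mul_left
    have j3 : Integrable fun z : ℝ × ℝ =>
        f z * (η z.1 * fderiv ℝ φ z (0, 1)) + g z * (η z.1 * φ z) := j1.add j2
    rw [← add_eq_zero_iff_eq_neg, ← integral_add j1 j2, Measure.volume_eq_prod,
      integral_prod _ j3] at key
    simp_rw [smul_eq_mul, ← integral_const_mul]
    refine Eq.trans ?_ key
    congr 1; ext x; congr 1; ext y; ring
  rw [Measure.restrict_univ, ← add_eq_zero_iff_eq_neg, ← integral_add i1 i2,
    Measure.volume_eq_prod, integral_prod _ i3]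
  have hCae : ∀ᵐ x : ℝ, x ∈ Cᶜ := compl_mem_ae_iff.2 hC0
  refine integral_eq_zero_of_ae ?_
  filter_upwards [hzero, hCae] with x hx hxC
  exact hx hxC

/-- For a locally integrable function on the line, integrating against a jointly continuous
compactly supported kernel gives a continuous function of the parameter. -/
theorem continuous_integral_mul_kernel {F : ℝ → ℝ} (hF : LocallyIntegrable F) {k : ℝ × ℝ → ℝ}
    (hk : Continuous k) (hkc : HasCompactSupport k) : Continuous fun q => ∫ x, F x * k (x, q) := by
  obtain ⟨B, hB⟩ := hkc.exists_bound_of_continuous hk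
  set K : Set ℝ := Prod.fst '' tsupport k
  have hK : IsCompact K := hkc.isCompact.image continuous_fst
  have hout : ∀ x ∉ K, ∀ q, k (x, q) = 0 := fun x hx q =>
    image_eq_zero_of_notMem_tsupport fun h => hx ⟨_, h, rfl⟩
  have hFK : IntegrableOn F K := hF.integrableOn_isCompact hK
  have hcont : Continuous fun q => ∫ x in K, F x * k (x, q) := by
    refine continuous_of_dominated (bound := fun x => ‖F x‖ * B) (fun q => ?_) (fun q => ?_)
      (hFK.norm.mul_const B) ?_
    · exact hFK.aestronglyMeasurable.mul
        (by fun_prop : Continuous fun x => k (x, q)).aestronglyMeasurable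
    · filter_upwards with x
      rw [norm_mul]
      exact mul_le_mul_of_nonneg_left (hB _) (norm_nonneg _)
    · filter_upwards with x
      fun_prop
  convert hcont using 2 with q
  refine (setIntegral_eq_integral_of_forall_compl_eq_zero fun x hx => ?_).symm
  rw [hout x hx, mul_zero]

/-- A weak horizontal derivative may be tested slice by slice: if for every test function `a` of
one variable, the slice of `g` is the derivative of the slice of `f` against `a` on almost every
horizontal line, then `g` is the weak horizontal derivative of `f`. -/
theorem hasWeakDirDeriv_horizontal_of_slicePair (hf : LocallyIntegrable f)
    (hg : LocallyIntegrable g) (hfs : ∀ᵐ y, LocallyIntegrable fun x => f (x, y))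
    (hgs : ∀ᵐ y, LocallyIntegrable fun x => g (x, y))
    (h : ∀ a : ℝ → ℝ, ContDiff ℝ ∞ a → HasCompactSupport a →
      ∀ᵐ y, slicePair f (deriv a) y + slicePair g a y = 0) :
    HasWeakDirDeriv univ (1, 0) f g := by
  intro φ hφ hφc _
  have hdc : HasCompactSupport fun z => fderiv ℝ φ z (1, 0) := hφc.fderiv_apply ℝ (1, 0)
  have hdcont := continuous_fderiv_apply_of_contDiff hφ (1, 0)
  have i1 : Integrable fun z => f z * fderiv ℝ φ z (1, 0) :=
    hf.integrable_smul_right_of_hasCompactSupport hdcont hdc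
  have i2 : Integrable fun z => g z * φ z :=
    hg.integrable_smul_right_of_hasCompactSupport hφ.continuous hφc
  have hslice : ∀ q : ℝ, ContDiff ℝ ∞ (fun x => φ (x, q)) ∧
      HasCompactSupport (fun x => φ (x, q)) ∧
      deriv (fun x => φ (x, q)) = fun x => fderiv ℝ φ (x, q) (1, 0) := fun q => by
    refine ⟨by fun_prop, ?_, ?_⟩
    · refine HasCompactSupport.intro (hφc.isCompact.image continuous_fst) fun x hx => ?_
      exact image_eq_zero_of_notMem_tsupport fun h => hx ⟨_, h, rfl⟩
    · ext x
      have h1 : HasDerivAt (fun x : ℝ => (x, q)) ((1 : ℝ), (0 : ℝ)) x :=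
        (hasDerivAt_id x).prodMk (hasDerivAt_const x q)
      exact (((hφ.differentiable (by simp)) (x, q)).hasFDerivAt.comp_hasDerivAt x h1).deriv
  have hq : ∀ᵐ y, ∀ q : ℚ, (∫ x, f (x, y) * fderiv ℝ φ (x, (q : ℝ)) (1, 0))
      + ∫ x, g (x, y) * φ (x, (q : ℝ)) = 0 := by
    rw [ae_all_iff]
    intro q
    obtain ⟨h1, h2, h3⟩ := hslice q
    filter_upwards [h _ h1 h2] with y hy
    rwa [h3] at hy
  rw [Measure.restrict_univ, ← add_eq_zero_iff_eq_neg, Measure.volume_eq_prod,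
    integral_prod_symm _ i1, integral_prod_symm _ i2,
    ← integral_add i1.integral_prod_right i2.integral_prod_right]
  refine integral_eq_zero_of_ae ?_
  filter_upwards [hq, hfs, hgs] with y hy hfy hgy
  -- The identity holds for the frozen test functions `φ(·, q)` with `q` rational, and both sides
  -- are continuous in `q`.
  have hcont := (continuous_integral_mul_kernel hfy hdcont hdc).add
    (continuous_integral_mul_kernel hgy hφ.continuous hφc)
  exact congrFun (Rat.denseRange_cast.equalizer hcont continuous_zero (funext hy)) y

end

/-! ### Multiscale covers of sets of finite Hausdorff measure -/

/-- Every length `d < 2⁻ᵏ` can be enlarged to a dyadic length `2⁻ᵐ ≤ 2⁻ᵏ` at the cost of a bounded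
factor and a small error in the `s`-th power; the error is needed for `d = 0` only. -/
theorem exists_dyadic_scale {s : ℝ} (hs : 0 ≤ s) {k : ℕ} {d : ℝ} (hd : 0 ≤ d)
    (hdk : d < (1 / 2) ^ k) {ε : ℝ} (hε : 0 < ε) :
    ∃ m, k ≤ m ∧ d < (1 / 2) ^ m ∧ ((1 / 2 : ℝ) ^ m) ^ s ≤ 2 ^ s * d ^ s + ε := by
  rcases hd.eq_or_lt with rfl | hd
  · rcases hs.eq_or_lt with rfl | hs
    · exact ⟨k, le_rfl, by positivity, by simp [hε.le]⟩
    · have h1 : Filter.Tendsto (fun m : ℕ => ((1 / 2 : ℝ) ^ m) ^ s) Filter.atTop (nhds 0) := by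
        have := (tendsto_pow_atTop_nhds_zero_of_lt_one (r := (1 / 2 : ℝ)) (by norm_num)
          (by norm_num)).rpow_const (p := s) (Or.inr hs.le)
        rwa [Real.zero_rpow hs.ne'] at this
      obtain ⟨m, hm, hkm⟩ := ((h1.eventually (ge_mem_nhds hε)).and
        (Filter.eventually_ge_atTop k)).exists
      refine ⟨m, hkm, by positivity, ?_⟩
      rw [Real.zero_rpow hs.ne', mul_zero, zero_add]
      exact hm
  · have hex : ∃ m, k ≤ m ∧ (1 / 2 : ℝ) ^ (m + 1) ≤ d := by
      obtain ⟨m, hm⟩ := exists_pow_lt_of_lt_one hd (by norm_num : (1 / 2 : ℝ) < 1)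
      refine ⟨max k m, le_max_left _ _, le_trans ?_ hm.le⟩
      exact pow_le_pow_of_le_one (by norm_num) (by norm_num) (by omega)
    classical
    obtain ⟨h1, h2⟩ := Nat.find_spec hex
    refine ⟨Nat.find hex, h1, ?_, ?_⟩
    · rcases h1.eq_or_lt with h | h
      · rwa [← h]
      · have h3 := Nat.find_min hex (m := Nat.find hex - 1) (by omega)
        rw [not_and, not_le] at h3
        have := h3 (by omega)
        rwa [Nat.sub_add_cancel (by omega)] at this
    · have : (1 / 2 : ℝ) ^ Nat.find hex ≤ 2 * d := by
        rw [pow_succ] at h2; linarith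
      calc _ ≤ (2 * d) ^ s := Real.rpow_le_rpow (by positivity) this hs
        _ = 2 ^ s * d ^ s := Real.mul_rpow (by norm_num) hd.le
        _ ≤ _ := by linarith

/-- The compact subsets of a set of finite `s`-dimensional Hausdorff measure have finite covers by
balls of arbitrarily small dyadic radii for which the sum of the `s`-th powers of the radii is
bounded independently of the mesh. The centers are grouped by scale: `S m` is the set of centers of
the balls of radius `2⁻ᵐ`. -/
theorem exists_multiscale_cover {C : Set ℝ} {s : ℝ} (hs : 0 ≤ s)
    (hC : Measure.hausdorffMeasure s C < ⊤) :
    ∃ M : ℝ, 0 ≤ M ∧ ∀ (k : ℕ) (K : Set ℝ), IsCompact K → K ⊆ C →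
      ∃ (N : ℕ) (S : ℕ → Finset ℝ),
        (∀ x ∈ K, ∃ m ∈ Finset.Ico k N, ∃ c ∈ S m, x ∈ Metric.ball c ((1 / 2) ^ m)) ∧
        ∑ m ∈ Finset.Ico k N, ((S m).card : ℝ) * ((1 / 2 : ℝ) ^ m) ^ s ≤ M := by
  refine ⟨2 ^ s * ((Measure.hausdorffMeasure s C).toReal + 1) + 2, by positivity, ?_⟩
  intro k K hK hKC
  have hr : (0 : ℝ) < (1 / 2) ^ (k + 1) := by positivity
  have hlt : (⨅ (t : ℕ → Set ℝ) (_ : C ⊆ ⋃ n, t n)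
      (_ : ∀ n, Metric.ediam (t n) ≤ ENNReal.ofReal ((1 / 2) ^ (k + 1))),
      ∑' n, ⨆ _ : (t n).Nonempty, Metric.ediam (t n) ^ s) <
        Measure.hausdorffMeasure s C + 1 := by
    refine lt_of_le_of_lt ?_ (ENNReal.lt_add_right hC.ne one_ne_zero)
    rw [Measure.hausdorffMeasure_apply s C]
    exact le_iSup₂_of_le (ENNReal.ofReal ((1 / 2) ^ (k + 1))) (ENNReal.ofReal_pos.2 hr) le_rfl
  simp only [iInf_lt_iff] at hlt
  obtain ⟨t, htC, htd, hsum⟩ := hlt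
  have hdfin : ∀ n, Metric.ediam (t n) ≠ ⊤ := fun n => ne_top_of_le_ne_top (by simp) (htd n)
  have hdk : ∀ n, (Metric.ediam (t n)).toReal < (1 / 2) ^ k := fun n => by
    have := ENNReal.toReal_mono (by simp) (htd n)
    rw [ENNReal.toReal_ofReal hr.le, pow_succ] at this
    have h0 : (0 : ℝ) < (1 / 2) ^ k := by positivity
    linarith
  choose m hkm hdm hms using fun n : ℕ =>
    exists_dyadic_scale hs ENNReal.toReal_nonneg (hdk n) (by positivity : (0 : ℝ) < (1 / 2) ^ n)
  have hx : ∀ n, ∃ x, (t n).Nonempty → x ∈ t n := fun n => by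
    rcases (t n).eq_empty_or_nonempty with h | ⟨x, hx⟩
    · exact ⟨0, fun h' => absurd h h'.ne_empty⟩
    · exact ⟨x, fun _ => hx⟩
  choose x hx using hx
  obtain ⟨I, hIb, hIfin, hIcov⟩ := hK.elim_finite_subcover_image
    (b := {n | (t n).Nonempty}) (c := fun n => Metric.ball (x n) ((1 / 2) ^ m n))
    (fun n _ => Metric.isOpen_ball) (fun y hy => by
      obtain ⟨n, hn⟩ := mem_iUnion.1 (htC (hKC hy))
      refine mem_biUnion (show n ∈ {n | (t n).Nonempty} from ⟨y, hn⟩) ?_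
      rw [Metric.mem_ball, dist_edist]
      refine lt_of_le_of_lt (ENNReal.toReal_mono (hdfin n) ?_) (hdm n)
      exact Metric.edist_le_ediam_of_mem hn (hx n ⟨y, hn⟩))
  classical
  set J := hIfin.toFinset
  have hJ : ∀ {n}, n ∈ J ↔ n ∈ I := by simp [J]
  have hmaps : ∀ n ∈ J, m n ∈ Finset.Ico k (J.sup m + 1) := fun n hn =>
    Finset.mem_Ico.2 ⟨hkm n, Nat.lt_succ_of_le (Finset.le_sup (f := m) hn)⟩
  refine ⟨J.sup m + 1, fun j => (J.filter fun n => m n = j).image x, ?_, ?_⟩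
  · intro y hy
    obtain ⟨n, hn, hyn⟩ := mem_iUnion₂.1 (hIcov hy)
    exact ⟨m n, hmaps n (hJ.2 hn), x n, Finset.mem_image_of_mem x (by simp [hJ.2 hn]), hyn⟩
  · have h1 : ∑ j ∈ Finset.Ico k (J.sup m + 1),
        (((J.filter fun n => m n = j).image x).card : ℝ) * ((1 / 2 : ℝ) ^ j) ^ s
        ≤ ∑ n ∈ J, ((1 / 2 : ℝ) ^ m n) ^ s := by
      rw [← Finset.sum_fiberwise_of_maps_to hmaps]
      refine Finset.sum_le_sum fun j _ => ?_
      rw [Finset.sum_congr rfl (g := fun _ => ((1 / 2 : ℝ) ^ j) ^ s)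
        fun n hn => by rw [(Finset.mem_filter.1 hn).2], Finset.sum_const, nsmul_eq_mul]
      gcongr
      exact Finset.card_image_le
    have h2 : ∑ n ∈ J, (Metric.ediam (t n)).toReal ^ s
        ≤ (Measure.hausdorffMeasure s C).toReal + 1 := by
      have h3 : ∑ n ∈ J, Metric.ediam (t n) ^ s ≤ Measure.hausdorffMeasure s C + 1 := by
        refine le_trans ?_ hsum.le
        refine le_trans (Finset.sum_le_sum fun n hn => ?_) (ENNReal.sum_le_tsum J)
        exact le_iSup_of_le (hIb (hJ.1 hn)) le_rfl
      have h4 := ENNReal.toReal_mono (ENNReal.add_ne_top.2 ⟨hC.ne, ENNReal.one_ne_top⟩) h3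
      rw [ENNReal.toReal_add hC.ne ENNReal.one_ne_top, ENNReal.toReal_one,
        ENNReal.toReal_sum fun n _ => ENNReal.rpow_ne_top_of_nonneg hs (hdfin n)] at h4
      simpa only [ENNReal.toReal_rpow] using h4
    have h5 : ∑ n ∈ J, (1 / 2 : ℝ) ^ n ≤ 2 := by
      exact (summable_geometric_two.sum_le_tsum J fun _ _ => by positivity).trans_eq
        tsum_geometric_two
    calc _ ≤ _ := h1
      _ ≤ ∑ n ∈ J, (2 ^ s * (Metric.ediam (t n)).toReal ^ s + (1 / 2) ^ n) :=
        Finset.sum_le_sum fun n _ => hms n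
      _ ≤ _ := by
        rw [Finset.sum_add_distrib, ← Finset.mul_sum]
        gcongr

/-! ### Cutoff functions -/

/-- A finite union of unit balls has a smooth cutoff function supported in the concentric balls of
radius three, with derivative bounded independently of the union. -/
theorem exists_cutoff_unit : ∃ A : ℝ, 0 ≤ A ∧ ∀ S : Finset ℝ, ∃ σ : ℝ → ℝ,
    ContDiff ℝ ∞ σ ∧ (∀ x, 0 ≤ σ x) ∧ (∀ x, σ x ≤ 1) ∧
    (∀ c ∈ S, ∀ x ∈ Metric.ball c 1, σ x = 1) ∧
    (∀ x, σ x ≠ 0 → ∃ c ∈ S, x ∈ Metric.ball c 3) ∧ ∀ x, |deriv σ x| ≤ A := by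
  -- `σ` is the convolution of a fixed mollifier with the indicator function of the union of the
  -- balls of radius two; its derivative is at most the `L¹` norm of the derivative of the mollifier.
  let b : ContDiffBump (0 : ℝ) := ⟨1 / 2, 1, by norm_num, by norm_num⟩
  set ρ : ℝ → ℝ := b.normed volume
  have hρ : ContDiff ℝ ∞ ρ := b.contDiff_normed
  have hρc : HasCompactSupport ρ := b.hasCompactSupport_normed
  have hρ1 : ∫ y, ρ y = 1 := b.integral_normed
  have hρ0 : ∀ x, 0 ≤ ρ x := b.nonneg_normed
  have hρs : ∀ x, ρ x ≠ 0 → |x| < 1 := fun x hx => by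
    have : x ∈ Function.support (b.normed volume) := hx
    rw [b.support_normed_eq] at this
    simpa using this
  have hρi : Integrable ρ := hρ.continuous.integrable_of_hasCompactSupport hρc
  have hρ' : Integrable (deriv ρ) :=
    (hρ.continuous_deriv (by simp)).integrable_of_hasCompactSupport hρc.deriv
  refine ⟨∫ y, |deriv ρ y|, integral_nonneg fun _ => abs_nonneg _, fun S => ?_⟩
  set V : Set ℝ := ⋃ c ∈ S, Metric.ball c 2
  have hV : MeasurableSet V := (isOpen_biUnion fun _ _ => Metric.isOpen_ball).measurableSet
  set χ : ℝ → ℝ := V.indicator fun _ => 1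
  have hχ0 : ∀ x, 0 ≤ χ x := fun x => indicator_nonneg (fun _ _ => zero_le_one) x
  have hχ1 : ∀ x, χ x ≤ 1 := fun x => indicator_le_self' (fun _ _ => zero_le_one) x
  have hχm : Measurable χ := measurable_const.indicator hV
  have hχ : LocallyIntegrable χ := (locallyIntegrable_const (1 : ℝ)).indicator hV
  let L := ContinuousLinearMap.mul ℝ ℝ
  have hmul : ∀ {w : ℝ → ℝ}, Integrable w → ∀ x, Integrable fun t => χ t * w (x - t) :=
    fun hw x => (hw.comp_sub_left x).bdd_mul hχm.aestronglyMeasurable (c := 1)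
      (Filter.Eventually.of_forall fun t => by
        rw [Real.norm_eq_abs, abs_of_nonneg (hχ0 t)]; exact hχ1 t)
  have hdef : ∀ (w : ℝ → ℝ) x, convolution χ w L volume x = ∫ t, χ t * w (x - t) := fun w x => rfl
  refine ⟨convolution χ ρ L volume, hρc.contDiff_convolution_right L hχ hρ, fun x => ?_,
    fun x => ?_, fun c hc x hx => ?_, fun x hx => ?_, fun x => ?_⟩
  · rw [hdef]
    exact integral_nonneg fun t => mul_nonneg (hχ0 t) (hρ0 _)
  · rw [hdef, ← hρ1, ← integral_sub_left_eq_self ρ volume x]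
    exact integral_mono (hmul hρi x) (hρi.comp_sub_left x) fun t =>
      mul_le_of_le_one_left (hρ0 _) (hχ1 t)
  · rw [hdef, ← hρ1, ← integral_sub_left_eq_self ρ volume x]
    congr 1; ext t
    by_cases ht : ρ (x - t) = 0
    · simp [ht]
    · have h1 := hρs _ ht
      have h2 : t ∈ V := mem_biUnion hc (by
        rw [Metric.mem_ball, Real.dist_eq] at hx ⊢
        rw [abs_lt] at *
        constructor <;> linarith)
      simp [χ, h2]
  · rw [hdef] at hx
    obtain ⟨t, ht⟩ : ∃ t, χ t * ρ (x - t) ≠ 0 := by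
      by_contra! h
      exact hx (by simp [h])
    have h1 := hρs _ (right_ne_zero_of_mul ht)
    obtain ⟨c, hc, htc⟩ := mem_iUnion₂.1 (mem_of_indicator_ne_zero (left_ne_zero_of_mul ht))
    refine ⟨c, hc, ?_⟩
    rw [Metric.mem_ball, Real.dist_eq] at htc ⊢
    rw [abs_lt] at *
    constructor <;> linarith
  · rw [(hρc.hasDerivAt_convolution_right L hχ (hρ.of_le (by simp)) x).deriv, hdef,
      ← integral_sub_left_eq_self (fun y => |deriv ρ y|) volume x]
    refine (abs_integral_le_integral_abs).trans ?_
    refine integral_mono (hmul hρ' x).abs (hρ'.comp_sub_left x).abs fun t => ?_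
    rw [abs_mul, abs_of_nonneg (hχ0 t)]
    exact mul_le_of_le_one_left (abs_nonneg _) (hχ1 t)

/-- Cutoff functions for finite unions of balls of a common radius `δ`, with derivative of order
`δ⁻¹`, independently of the union. -/
theorem exists_cutoff : ∃ A : ℝ, 0 ≤ A ∧ ∀ (δ : ℝ), 0 < δ → ∀ S : Finset ℝ, ∃ σ : ℝ → ℝ,
    ContDiff ℝ ∞ σ ∧ (∀ x, 0 ≤ σ x) ∧ (∀ x, σ x ≤ 1) ∧
    (∀ c ∈ S, ∀ x ∈ Metric.ball c δ, σ x = 1) ∧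
    tsupport σ ⊆ ⋃ c ∈ S, Metric.closedBall c (3 * δ) ∧ ∀ x, |deriv σ x| ≤ A * δ⁻¹ := by
  classical
  obtain ⟨A, hA, h⟩ := exists_cutoff_unit
  refine ⟨A, hA, fun δ hδ S => ?_⟩
  obtain ⟨σ, h1, h2, h3, h4, h5, h6⟩ := h (S.image fun c => δ⁻¹ * c)
  have hball : ∀ c x r, δ⁻¹ * x ∈ Metric.ball (δ⁻¹ * c) r ↔ x ∈ Metric.ball c (r * δ) := by
    intro c x r
    rw [Metric.mem_ball, Metric.mem_ball, Real.dist_eq, Real.dist_eq, ← mul_sub, abs_mul,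
      abs_of_pos (inv_pos.2 hδ), inv_mul_lt_iff₀ hδ, mul_comm]
  refine ⟨fun x => σ (δ⁻¹ * x), by fun_prop, fun x => h2 _, fun x => h3 _, fun c hc x hx => ?_,
    ?_, fun x => ?_⟩
  · exact h4 (δ⁻¹ * c) (Finset.mem_image_of_mem _ hc) _ ((hball c x 1).2 (by rwa [one_mul]))
  · refine closure_minimal (fun x hx => ?_)
      (S.finite_toSet.isClosed_biUnion fun _ _ => Metric.isClosed_closedBall)
    obtain ⟨c', hc', hx'⟩ := h5 _ hx
    obtain ⟨c, hc, rfl⟩ := Finset.mem_image.1 hc'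
    exact mem_biUnion hc (Metric.ball_subset_closedBall ((hball c x 3).1 hx'))
  · have hd : HasDerivAt (fun x => σ (δ⁻¹ * x)) (deriv σ (δ⁻¹ * x) * (δ⁻¹ * 1)) x :=
      ((h1.differentiable (by simp)) (δ⁻¹ * x)).hasDerivAt.comp x
        ((hasDerivAt_id x).const_mul δ⁻¹)
    rw [hd.deriv, mul_one, abs_mul, abs_of_pos (inv_pos.2 hδ)]
    exact mul_le_mul_of_nonneg_right (h6 _) (inv_pos.2 hδ).le

/-! ### Multiscale decomposition of a test function -/

theorem volume_biUnion_closedBall_le (S : Finset ℝ) (r : ℝ) :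
    volume (⋃ c ∈ S, Metric.closedBall c r) ≤ ENNReal.ofReal (S.card * (2 * r)) := by
  refine (measure_biUnion_finset_le S _).trans ?_
  simp only [Real.volume_closedBall, Finset.sum_const, nsmul_eq_mul]
  rw [ENNReal.ofReal_mul (Nat.cast_nonneg _), ENNReal.ofReal_natCast]

/-- If `Pₖ = 1` and `Pₘ₊₁ = Pₘ (1 - σₘ)`, the differences `Pₘ - Pₘ₊₁ = σₘ Pₘ` telescope. -/
theorem sum_mul_prod_one_sub (σ : ℕ → ℝ) (k N : ℕ) :
    ∑ m ∈ Finset.Ico k N, σ m * ∏ j ∈ Finset.Ico k m, (1 - σ j)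
      = 1 - ∏ j ∈ Finset.Ico k N, (1 - σ j) := by
  induction N with
  | zero => simp
  | succ N ih =>
    by_cases h : k ≤ N
    · rw [Finset.sum_Ico_succ_top h, Finset.prod_Ico_succ_top h, ih]
      ring
    · simp [Finset.Ico_eq_empty_of_le (by omega : N + 1 ≤ k)]

/-- The derivatives of the factors form a geometric progression, so the derivative of the product is
of the order of the derivative of the next factor. -/
theorem abs_deriv_prod_one_sub_le {σ : ℕ → ℝ → ℝ} (hσ : ∀ m, ContDiff ℝ ∞ (σ m))
    (h0 : ∀ m x, 0 ≤ σ m x) (h1 : ∀ m x, σ m x ≤ 1) {A : ℝ} (hA : 0 ≤ A)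
    (hd : ∀ m x, |deriv (σ m) x| ≤ A * 2 ^ m) (k m : ℕ) (x : ℝ) :
    |deriv (fun x => ∏ j ∈ Finset.Ico k m, (1 - σ j x)) x| ≤ A * 2 ^ m := by
  induction m with
  | zero => simpa using hA
  | succ m ih =>
    by_cases h : k ≤ m
    · simp only [Finset.prod_Ico_succ_top h]
      have hP : ContDiff ℝ ∞ fun x => ∏ j ∈ Finset.Ico k m, (1 - σ j x) :=
        contDiff_prod fun j _ => contDiff_const.sub (hσ j)
      have hd1 := ((hP.differentiable (by simp)) x).hasDerivAt
      have hd2 := (((hσ m).differentiable (by simp)) x).hasDerivAt.const_sub 1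
      rw [(hd1.fun_mul hd2).deriv]
      have hp0 : 0 ≤ ∏ j ∈ Finset.Ico k m, (1 - σ j x) :=
        Finset.prod_nonneg fun j _ => sub_nonneg.2 (h1 j x)
      have hp1 : ∏ j ∈ Finset.Ico k m, (1 - σ j x) ≤ 1 :=
        Finset.prod_le_one (fun j _ => sub_nonneg.2 (h1 j x)) fun j _ => by linarith [h0 j x]
      calc _ ≤ _ := abs_add_le _ _
        _ ≤ A * 2 ^ m * 1 + 1 * (A * 2 ^ m) := by
          rw [abs_mul, abs_mul, abs_neg, abs_of_nonneg (sub_nonneg.2 (h1 m x)), abs_of_nonneg hp0]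
          gcongr
          · exact sub_nonneg.2 (h1 m x)
          · linarith [h0 m x]
          · exact hd m x
        _ = A * 2 ^ (m + 1) := by ring
    · simp only [Finset.Ico_eq_empty_of_le (by omega : m + 1 ≤ k), Finset.prod_empty, deriv_const,
        abs_zero]
      positivity

/-- A test function `ψ` of one variable decomposes near a closed set `C` of finite `s`-dimensional
Hausdorff measure into pieces `u m` of scale `2⁻ᵐ`, with `m ≥ k` for any prescribed `k`, up to a
remainder supported away from `C`. The derivative of `u m` is of order `2ᵐ`, and `u m` is supported
in a set `T m` of measure at most `b m 2^{-m(1-s)}`, where the sums of the `b m` and of the `|u m|`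
are bounded independently of `k`. -/
theorem exists_multiscale_decomposition {C : Set ℝ} (hCc : IsClosed C) {s : ℝ} (hs : 0 ≤ s)
    (hC : Measure.hausdorffMeasure s C < ⊤) {ψ : ℝ → ℝ} (hψ : ContDiff ℝ ∞ ψ)
    (hψc : HasCompactSupport ψ) :
    ∃ A : ℝ, 0 ≤ A ∧ ∀ k : ℕ, ∃ (N : ℕ) (u : ℕ → ℝ → ℝ) (T : ℕ → Set ℝ) (b : ℕ → ℝ),
      (∀ m, ContDiff ℝ ∞ (u m)) ∧ (∀ m, HasCompactSupport (u m)) ∧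
      (∀ m, tsupport (u m) ⊆ T m) ∧ (∀ m, MeasurableSet (T m)) ∧ (∀ m, 0 ≤ b m) ∧
      (∀ m, volume (T m) ≤ ENNReal.ofReal (b m * ((1 / 2 : ℝ) ^ m) ^ (1 - s))) ∧
      (∀ m x, |deriv (u m) x| ≤ A * 2 ^ m) ∧
      (∀ x, ∑ m ∈ Finset.Ico k N, |u m x| ≤ A) ∧
      ∑ m ∈ Finset.Ico k N, b m ≤ A ∧
      Disjoint (tsupport fun x => ψ x - ∑ m ∈ Finset.Ico k N, u m x) C := by
  obtain ⟨A₀, hA₀, hcut⟩ := exists_cutoff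
  obtain ⟨M, hM, hcov⟩ := exists_multiscale_cover hs hC
  obtain ⟨D, hD⟩ := hψc.exists_bound_of_continuous hψ.continuous
  obtain ⟨D', hD'⟩ := hψc.deriv.exists_bound_of_continuous (hψ.continuous_deriv (by simp))
  simp only [Real.norm_eq_abs] at hD hD'
  have hD0 : 0 ≤ D := (abs_nonneg _).trans (hD 0)
  have hD0' : 0 ≤ D' := (abs_nonneg _).trans (hD' 0)
  refine ⟨D' + 2 * D * A₀ + D + 6 * M, by positivity, fun k => ?_⟩
  obtain ⟨N, S, hS, hsum⟩ := hcov k (tsupport ψ ∩ C) (hψc.isCompact.inter_right hCc)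
    inter_subset_right
  choose σ hσ hσ0 hσ1 hσS hσT hσd using fun m : ℕ =>
    hcut ((1 / 2) ^ m) (by positivity) (S m)
  have hσd' : ∀ m x, |deriv (σ m) x| ≤ A₀ * 2 ^ m := fun m x => by
    have := hσd m x
    rwa [one_div, inv_pow, inv_inv] at this
  -- The pieces are `u m = ψ σₘ Pₘ = ψ (Pₘ - Pₘ₊₁)`, and the remainder is `ψ P_N`, which vanishes
  -- near `C` because one of the factors `1 - σₘ` does.
  set P : ℕ → ℝ → ℝ := fun m x => ∏ j ∈ Finset.Ico k m, (1 - σ j x)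
  have hP : ∀ m, ContDiff ℝ ∞ (P m) := fun m => contDiff_prod fun j _ => contDiff_const.sub (hσ j)
  have hP0 : ∀ m x, 0 ≤ P m x := fun m x => Finset.prod_nonneg fun j _ => sub_nonneg.2 (hσ1 j x)
  have hP1 : ∀ m x, P m x ≤ 1 := fun m x =>
    Finset.prod_le_one (fun j _ => sub_nonneg.2 (hσ1 j x)) fun j _ => by linarith [hσ0 j x]
  have htel : ∀ x, ∑ m ∈ Finset.Ico k N, σ m x * P m x = 1 - P N x := fun x =>
    sum_mul_prod_one_sub (fun m => σ m x) k N
  have hsumu : ∀ x, ∑ m ∈ Finset.Ico k N, ψ x * (σ m x * P m x) = ψ x * (1 - P N x) := fun x => by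
    rw [← Finset.mul_sum, htel]
  refine ⟨N, fun m x => ψ x * (σ m x * P m x),
    fun m => ⋃ c ∈ S m, Metric.closedBall c (3 * (1 / 2) ^ m),
    fun m => 6 * ((S m).card * ((1 / 2 : ℝ) ^ m) ^ s), fun m => hψ.mul ((hσ m).mul (hP m)),
    fun m => hψc.mul_right, fun m => ?_, fun m => ?_, fun m => by positivity, fun m => ?_,
    fun m x => ?_, fun x => ?_, ?_, ?_⟩
  · refine (closure_mono fun x hx => ?_).trans (hσT m)
    exact left_ne_zero_of_mul (right_ne_zero_of_mul hx)
  · exact Finset.measurableSet_biUnion _ fun _ _ => measurableSet_closedBall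
  · refine (volume_biUnion_closedBall_le (S m) _).trans_eq ?_
    congr 1
    have : ((1 / 2 : ℝ) ^ m) ^ s * ((1 / 2 : ℝ) ^ m) ^ (1 - s) = (1 / 2) ^ m := by
      rw [← Real.rpow_add (by positivity), add_sub_cancel, Real.rpow_one]
    linear_combination (-6 * ((S m).card : ℝ)) * this
  · have hd1 := ((hψ.differentiable (by simp)) x).hasDerivAt
    have hd2 := (((hσ m).differentiable (by simp)) x).hasDerivAt
    have hd3 := (((hP m).differentiable (by simp)) x).hasDerivAt
    rw [(hd1.fun_mul (hd2.fun_mul hd3)).deriv]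
    have e1 : |deriv ψ x * (σ m x * P m x)| ≤ D' * 1 := by
      rw [abs_mul, abs_of_nonneg (mul_nonneg (hσ0 m x) (hP0 m x))]
      gcongr
      · exact mul_nonneg (hσ0 m x) (hP0 m x)
      · exact hD' x
      · exact mul_le_one₀ (hσ1 m x) (hP0 m x) (hP1 m x)
    have e2 : |deriv (σ m) x * P m x| ≤ A₀ * 2 ^ m * 1 := by
      rw [abs_mul, abs_of_nonneg (hP0 m x)]
      gcongr
      · exact hP0 m x
      · exact hσd' m x
      · exact hP1 m x
    have e3 : |σ m x * deriv (P m) x| ≤ 1 * (A₀ * 2 ^ m) := by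
      rw [abs_mul, abs_of_nonneg (hσ0 m x)]
      gcongr
      · exact hσ1 m x
      · exact abs_deriv_prod_one_sub_le hσ hσ0 hσ1 hA₀ hσd' k m x
    have e4 : |ψ x * (deriv (σ m) x * P m x + σ m x * deriv (P m) x)|
        ≤ D * (2 * (A₀ * 2 ^ m)) := by
      rw [abs_mul]
      gcongr
      · exact hD x
      · exact (abs_add_le _ _).trans (by linarith)
    have h2 : (1 : ℝ) ≤ 2 ^ m := one_le_pow₀ one_le_two
    calc _ ≤ _ := abs_add_le _ _
      _ ≤ D' * 1 + D * (2 * (A₀ * 2 ^ m)) := add_le_add e1 e4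
      _ ≤ D' * 2 ^ m + D * (2 * (A₀ * 2 ^ m)) + (D + 6 * M) * 2 ^ m := by
        have : 0 ≤ (D + 6 * M) * 2 ^ m := by positivity
        nlinarith
      _ = _ := by ring
  · have : ∀ m, |ψ x * (σ m x * P m x)| = |ψ x| * (σ m x * P m x) := fun m => by
      rw [abs_mul, abs_of_nonneg (mul_nonneg (hσ0 m x) (hP0 m x))]
    simp only [this]
    rw [← Finset.mul_sum, htel]
    have h1 : |ψ x| * (1 - P N x) ≤ D * 1 := by
      gcongr
      · linarith [hP1 N x]
      · exact hD x
      · linarith [hP0 N x]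
    have : 0 ≤ D' + 2 * D * A₀ + 6 * M := by positivity
    linarith
  · rw [← Finset.mul_sum]
    have : 0 ≤ D' + 2 * D * A₀ + D := by positivity
    linarith
  · rw [disjoint_left]
    intro x hx hxC
    simp only [hsumu] at hx
    have hrem : (fun x => ψ x - ψ x * (1 - P N x)) = fun x => ψ x * P N x := by ext x; ring
    rw [hrem] at hx
    have hxψ : x ∈ tsupport ψ := closure_mono (fun y hy => left_ne_zero_of_mul hy) hx
    obtain ⟨m, hm, c, hc, hxc⟩ := hS x ⟨hxψ, hxC⟩
    refine (notMem_tsupport_iff_eventuallyEq.2 ?_) hx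
    filter_upwards [Metric.isOpen_ball.mem_nhds hxc] with y hy
    have : P N y = 0 := Finset.prod_eq_zero hm (by rw [hσS m c hc y hy, sub_self])
    simp [this]

/-! ### Estimates for pairings with slices -/

/-- Almost every horizontal slice of an `L^p` function on the plane is in `L^p`. -/
theorem MeasureTheory.MemLp.ae_memLp_slice {f : ℝ × ℝ → ℝ} {p : ℝ≥0∞} (hf : MemLp f p)
    (hp0 : p ≠ 0) (hp : p ≠ ⊤) : ∀ᵐ y, MemLp (fun x => f (x, y)) p := by
  filter_upwards [hf.1.prodMk_right, (hf.integrable_norm_rpow hp0 hp).prod_left_ae] with y h1 h2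
  exact (integrable_norm_rpow_iff h1 hp0 hp).1 h2

/-- Hölder's inequality for the integral over a set. -/
theorem setLIntegral_enorm_le_eLpNorm_mul {α : Type*} [MeasurableSpace α] {μ : Measure α}
    {h : α → ℝ} {p : ℝ} (hp : 1 ≤ p) (hh : AEStronglyMeasurable h μ) (W : Set α) :
    ∫⁻ z in W, ‖h z‖ₑ ∂μ ≤ eLpNorm h (ENNReal.ofReal p) μ * μ W ^ (1 - 1 / p) := by
  have h1 := eLpNorm_le_eLpNorm_mul_rpow_measure_univ (p := 1) (q := ENNReal.ofReal p)
    (by rwa [ENNReal.one_le_ofReal]) (hh.mono_measure (Measure.restrict_le_self (s := W)))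
  rw [eLpNorm_one_eq_lintegral_enorm, Measure.restrict_apply_univ, ENNReal.toReal_one, div_one,
    ENNReal.toReal_ofReal (by linarith)] at h1
  refine h1.trans ?_
  gcongr
  exact Measure.restrict_le_self

theorem enorm_slicePair_le (f : ℝ × ℝ → ℝ) (a : ℝ → ℝ) (y : ℝ) :
    ‖slicePair f a y‖ₑ ≤ ∫⁻ x, ‖f (x, y)‖ₑ * ‖a x‖ₑ := by
  refine (enorm_integral_le_lintegral_enorm _).trans_eq ?_
  simp only [enorm_mul]

theorem setLIntegral_univ_prod {Φ : ℝ × ℝ → ℝ≥0∞} (hΦ : AEMeasurable Φ) (V : Set ℝ) :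
    ∫⁻ y in V, ∫⁻ x, Φ (x, y) = ∫⁻ z in univ ×ˢ V, Φ z := by
  have e : (volume : Measure (ℝ × ℝ)).restrict (univ ×ˢ V) = volume.prod (volume.restrict V) := by
    rw [Measure.volume_eq_prod, ← Measure.prod_restrict, Measure.restrict_univ]
  rw [e, lintegral_prod_symm]
  rw [← e]
  exact hΦ.restrict

theorem setLIntegral_enorm_slicePair_le {h : ℝ × ℝ → ℝ} (hh : AEStronglyMeasurable h)
    {a : ℝ → ℝ} (ha : Continuous a) (V : Set ℝ) :
    ∫⁻ y in V, ‖slicePair h a y‖ₑ ≤ ∫⁻ z in univ ×ˢ V, ‖h z‖ₑ * ‖a z.1‖ₑ := by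
  have hm : Measurable fun z : ℝ × ℝ => ‖a z.1‖ₑ := (ha.comp continuous_fst).measurable.enorm
  have hΦ : AEMeasurable fun z : ℝ × ℝ => ‖h z‖ₑ * ‖a z.1‖ₑ := hh.enorm.mul hm.aemeasurable
  rw [← setLIntegral_univ_prod hΦ]
  exact lintegral_mono fun y => enorm_slicePair_le h a y

/-- Hölder's inequality for pairings with a bounded function supported in `T`. -/
theorem setLIntegral_enorm_slicePair_le_of_support {h : ℝ × ℝ → ℝ}
    (hh : AEStronglyMeasurable h) {p : ℝ} (hp : 1 ≤ p) {a : ℝ → ℝ} (ha : Continuous a)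
    {T V : Set ℝ} (hT : MeasurableSet T) (hV : MeasurableSet V)
    (haT : Function.support a ⊆ T) {B : ℝ} (haB : ∀ x, |a x| ≤ B) :
    ∫⁻ y in V, ‖slicePair h a y‖ₑ ≤ ENNReal.ofReal B *
      (eLpNorm h (ENNReal.ofReal p) volume * (volume T * volume V) ^ (1 - 1 / p)) := by
  have h1 : ∫⁻ z in univ ×ˢ V, ‖h z‖ₑ * ‖a z.1‖ₑ
      ≤ ENNReal.ofReal B * ∫⁻ z in T ×ˢ V, ‖h z‖ₑ := by
    rw [← lintegral_const_mul' _ _ ENNReal.ofReal_ne_top,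
      ← lintegral_indicator (MeasurableSet.univ.prod hV), ← lintegral_indicator (hT.prod hV)]
    refine lintegral_mono fun z => ?_
    by_cases hz : z ∈ (univ : Set ℝ) ×ˢ V
    · rw [indicator_of_mem hz]
      by_cases hzT : z.1 ∈ T
      · rw [indicator_of_mem (show z ∈ T ×ˢ V from ⟨hzT, hz.2⟩), mul_comm]
        gcongr
        rw [Real.enorm_eq_ofReal_abs]
        exact ENNReal.ofReal_le_ofReal (haB _)
      · have : a z.1 = 0 := by
          by_contra hne
          exact hzT (haT hne)
        simp [this]
    · rw [indicator_of_notMem hz]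
      exact zero_le
  refine (setLIntegral_enorm_slicePair_le hh ha V).trans (h1.trans ?_)
  gcongr
  refine (setLIntegral_enorm_le_eLpNorm_mul hp hh _).trans_eq ?_
  rw [Measure.volume_eq_prod, Measure.prod_prod]

/-- Hölder's inequality for pairings with `u`, weighted by `|u|`. -/
theorem setLIntegral_enorm_slicePair_le_weighted {g : ℝ × ℝ → ℝ} (hg : AEStronglyMeasurable g)
    {p : ℝ} (hp : 1 < p) {u : ℝ → ℝ} (hu : Continuous u) (V : Set ℝ) :
    ∫⁻ y in V, ‖slicePair g u y‖ₑ ≤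
      (∫⁻ z in univ ×ˢ V, ‖g z‖ₑ ^ p * ‖u z.1‖ₑ) ^ (1 / p) *
        ((∫⁻ x, ‖u x‖ₑ) * volume V) ^ (1 - 1 / p) := by
  have hp0 : 0 < p := by linarith
  have hpq : p.HolderConjugate p.conjExponent := .conjExponent hp
  have hq : 1 / p.conjExponent = 1 - 1 / p := by
    rw [one_div, one_div, ← hpq.inv_add_inv_eq_one]
    ring
  have hq0 : 0 < p.conjExponent := hpq.symm.pos
  refine (setLIntegral_enorm_slicePair_le hg hu V).trans ?_
  have hgm : AEMeasurable (fun z : ℝ × ℝ => ‖g z‖ₑ) (volume.restrict (univ ×ˢ V)) :=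
    hg.enorm.mono_measure Measure.restrict_le_self
  have hum : Measurable fun z : ℝ × ℝ => ‖u z.1‖ₑ := (hu.comp continuous_fst).measurable.enorm
  have key := ENNReal.lintegral_mul_le_Lp_mul_Lq (volume.restrict ((univ : Set ℝ) ×ˢ V)) hpq
    (f := fun z => ‖g z‖ₑ * ‖u z.1‖ₑ ^ (1 / p)) (g := fun z => ‖u z.1‖ₑ ^ (1 / p.conjExponent))
    (hgm.mul (hum.pow_const _).aemeasurable) (hum.pow_const _).aemeasurable
  have e1 : ∀ z : ℝ × ℝ, ‖g z‖ₑ * ‖u z.1‖ₑ ^ (1 / p) * ‖u z.1‖ₑ ^ (1 / p.conjExponent)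
      = ‖g z‖ₑ * ‖u z.1‖ₑ := fun z => by
    rw [mul_assoc, ← ENNReal.rpow_add_of_nonneg _ _ (by positivity) (by positivity),
      hq, add_sub_cancel, ENNReal.rpow_one]
  have e2 : ∀ z : ℝ × ℝ, (‖g z‖ₑ * ‖u z.1‖ₑ ^ (1 / p)) ^ p = ‖g z‖ₑ ^ p * ‖u z.1‖ₑ := fun z => by
    rw [ENNReal.mul_rpow_of_nonneg _ _ hp0.le, ← ENNReal.rpow_mul, one_div_mul_cancel hp0.ne',
      ENNReal.rpow_one]
  have e3 : ∀ z : ℝ × ℝ, (‖u z.1‖ₑ ^ (1 / p.conjExponent)) ^ p.conjExponent = ‖u z.1‖ₑ :=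
    fun z => by rw [← ENNReal.rpow_mul, one_div_mul_cancel hq0.ne', ENNReal.rpow_one]
  have e4 : ∫⁻ z in (univ : Set ℝ) ×ˢ V, ‖u z.1‖ₑ = (∫⁻ x, ‖u x‖ₑ) * volume V := by
    rw [← setLIntegral_univ_prod hum.aemeasurable]
    exact setLIntegral_const V (∫⁻ x, ‖u x‖ₑ)
  simp only [Pi.mul_apply, e1, e2, e3, e4] at key
  rw [hq] at key
  exact key

/-- The estimate at a single scale: on almost every line, the pairing of the slice of `f` with `u'`
is compared with the pairings on the lines at distance less than `δ` that miss `F`. The difference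
is controlled by the vertical derivative `h`, and on a line that misses `F` the derivative is moved
from `u` to `f`. -/
theorem ae_enorm_slicePair_deriv_mul_le {f g h : ℝ × ℝ → ℝ} (hf : LocallyIntegrable f)
    (hg : LocallyIntegrable g) (hh : LocallyIntegrable h) {C F : Set ℝ} (hF : IsClosed F)
    (hwx : HasWeakDirDeriv (C ×ˢ F)ᶜ (1, 0) f g) (hwy : HasWeakDirDeriv univ (0, 1) f h)
    {u : ℝ → ℝ} (hu : ContDiff ℝ ∞ u) (huc : HasCompactSupport u) :
    ∀ᵐ y, ∀ δ : ℝ, ‖slicePair f (deriv u) y‖ₑ * volume (Metric.ball y δ \ F) ≤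
      (∫⁻ t in Metric.ball y δ, ‖slicePair h (deriv u) t‖ₑ) * volume (Metric.ball y δ \ F) +
        ∫⁻ t in Metric.ball y δ \ F, ‖slicePair g u t‖ₑ := by
  have hu' : ContDiff ℝ ∞ (deriv u) := (contDiff_infty_iff_deriv.1 hu).2
  obtain ⟨c, hc⟩ := exists_ae_slicePair_eq_add_intervalIntegral hf hh hwy hu' huc.deriv
  have hgap := ae_slicePair_deriv_add_slicePair_eq_zero hf hg hwx hu huc hF.isOpen_compl
    fun z hz hzE => hz.2 hzE.2
  have hloc := locallyIntegrable_slicePair hh hu'.continuous huc.deriv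
  have hi : ∀ a b, IntervalIntegrable (slicePair h (deriv u)) volume a b := fun a b =>
    (hloc.integrableOn_isCompact isCompact_uIcc).intervalIntegrable
  filter_upwards [hc] with y hy δ
  have hG : MeasurableSet (Metric.ball y δ \ F) := measurableSet_ball.diff hF.measurableSet
  rw [← setLIntegral_const, ← setLIntegral_const, ← lintegral_add_left measurable_const]
  refine setLIntegral_mono_ae' hG ?_
  filter_upwards [hc, hgap] with t ht htF htG
  have h1 : slicePair f (deriv u) y
      = (∫ v in t..y, slicePair h (deriv u) v) + -slicePair g u t := by
    rw [← eq_neg_of_add_eq_zero_left (htF htG.2), hy, ht,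
      ← intervalIntegral.integral_add_adjacent_intervals (hi 0 t) (hi t y)]
    ring
  rw [h1]
  refine (enorm_add_le _ _).trans ?_
  rw [enorm_neg]
  gcongr
  have hsub : uIoc t y ⊆ Metric.ball y δ := by
    refine uIoc_subset_uIcc.trans ?_
    have hb := (convex_ball y δ).ordConnected
    exact hb.uIcc_subset htG.1 (Metric.mem_ball_self (Metric.pos_of_mem_ball htG.1))
  have h2 : ‖∫ v in t..y, slicePair h (deriv u) v‖ₑ
      ≤ ∫⁻ v in uIoc t y, ‖slicePair h (deriv u) v‖ₑ := by
    rw [← ofReal_norm, intervalIntegral.norm_intervalIntegral_eq, ofReal_norm]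
    exact enorm_integral_le_lintegral_enorm _
  exact h2.trans (lintegral_mono_set hsub)

/-- The vertical term at scale `2⁻ᵐ` decays geometrically in `m` when `(2 - s)(1 - 1/p) > 1`. -/
theorem vertical_term_le {h : ℝ × ℝ → ℝ} (hh : AEStronglyMeasurable h) {p s : ℝ} (hp : 1 ≤ p)
    {a : ℝ → ℝ} (ha : Continuous a) {T : Set ℝ} (hT : MeasurableSet T)
    (haT : Function.support a ⊆ T) {A b : ℝ} (hA : 0 ≤ A) (hb : 0 ≤ b) (hbA : b ≤ A) {m : ℕ}
    (haA : ∀ x, |a x| ≤ A * 2 ^ m)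
    (hTb : volume T ≤ ENNReal.ofReal (b * ((1 / 2 : ℝ) ^ m) ^ (1 - s))) (y : ℝ) :
    ∫⁻ t in Metric.ball y ((1 / 2) ^ m), ‖slicePair h a t‖ₑ ≤
      eLpNorm h (ENNReal.ofReal p) volume * ENNReal.ofReal
        (A * (2 * A) ^ (1 - 1 / p) * ((1 / 2) ^ ((2 - s) * (1 - 1 / p) - 1)) ^ m) := by
  have he : 0 ≤ 1 - 1 / p := by
    rw [sub_nonneg, div_le_one (by linarith)]; exact hp
  refine (setLIntegral_enorm_slicePair_le_of_support hh hp ha hT measurableSet_ball haT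
    haA).trans ?_
  set δ : ℝ := (1 / 2) ^ m
  have hδ : 0 < δ := by positivity
  have h2 : (2 : ℝ) ^ m = δ ^ (-1 : ℝ) := by
    rw [Real.rpow_neg_one]; simp [δ]
  have h3 : volume T * volume (Metric.ball y δ) ≤ ENNReal.ofReal (2 * A * δ ^ (2 - s)) := by
    rw [Real.volume_ball]
    refine (mul_le_mul_left hTb _).trans ?_
    rw [← ENNReal.ofReal_mul (by positivity)]
    apply ENNReal.ofReal_le_ofReal
    calc b * δ ^ (1 - s) * (2 * δ) = 2 * b * (δ ^ (1 - s) * δ ^ (1 : ℝ)) := by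
          rw [Real.rpow_one]; ring
      _ = 2 * b * δ ^ (2 - s) := by rw [← Real.rpow_add hδ]; ring_nf
      _ ≤ _ := by gcongr
  have h4 : (ENNReal.ofReal (2 * A * δ ^ (2 - s))) ^ (1 - 1 / p)
      = ENNReal.ofReal ((2 * A) ^ (1 - 1 / p) * δ ^ ((2 - s) * (1 - 1 / p))) := by
    rw [ENNReal.ofReal_rpow_of_nonneg (by positivity) he,
      Real.mul_rpow (by positivity) (by positivity), ← Real.rpow_mul hδ.le]
  calc _ ≤ ENNReal.ofReal (A * 2 ^ m) * (eLpNorm h (ENNReal.ofReal p) volume *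
        ENNReal.ofReal ((2 * A) ^ (1 - 1 / p) * δ ^ ((2 - s) * (1 - 1 / p)))) := by
        rw [← h4]
        gcongr
    _ = eLpNorm h (ENNReal.ofReal p) volume * ENNReal.ofReal
        (A * 2 ^ m * ((2 * A) ^ (1 - 1 / p) * δ ^ ((2 - s) * (1 - 1 / p)))) := by
        rw [ENNReal.ofReal_mul (p := A * 2 ^ m) (by positivity)]; ring
    _ = _ := by
        congr 2
        have h5 : ((1 / 2 : ℝ) ^ ((2 - s) * (1 - 1 / p) - 1)) ^ m
            = δ ^ ((2 - s) * (1 - 1 / p)) * δ ^ (-1 : ℝ) := by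
          rw [← Real.rpow_add hδ, ← Real.rpow_natCast, ← Real.rpow_mul (by norm_num),
            mul_comm _ (m : ℝ), Real.rpow_mul (by norm_num), Real.rpow_natCast, ← sub_eq_add_neg]
        rw [h5, h2]; ring

/-- The horizontal term at scale `δ`: the exponent `(1 - s)(p - 1)` in the lower bound for the
measure of `G` is the one for which the powers of `δ` cancel. -/
theorem horizontal_term_le {g : ℝ × ℝ → ℝ} (hg : AEStronglyMeasurable g) {p s : ℝ} (hp : 1 < p)
    {u : ℝ → ℝ} (hu : Continuous u) {T : Set ℝ} (hT : MeasurableSet T)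
    (huT : Function.support u ⊆ T) {A b c δ : ℝ} (hA : 0 ≤ A) (hb : 0 ≤ b) (hc : 0 < c)
    (hδ : 0 < δ) (huA : ∀ x, |u x| ≤ A) (hTb : volume T ≤ ENNReal.ofReal (b * δ ^ (1 - s)))
    {G : Set ℝ} (hG : volume G ≠ ⊤)
    (hGc : ENNReal.ofReal (c * δ ^ ((1 - s) * (p - 1))) ≤ volume G) :
    ∫⁻ t in G, ‖slicePair g u t‖ₑ ≤ ENNReal.ofReal (c ^ (-(1 / p))) *
      ((∫⁻ z in univ ×ˢ G, ‖g z‖ₑ ^ p * ‖u z.1‖ₑ) ^ (1 / p) *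
        ENNReal.ofReal (A * b) ^ (1 - 1 / p)) * volume G := by
  have hp0 : 0 < p := by linarith
  have he : 0 ≤ 1 - 1 / p := by
    rw [sub_nonneg, div_le_one hp0]; exact hp.le
  refine (setLIntegral_enorm_slicePair_le_weighted hg hp hu G).trans ?_
  set a := (∫⁻ z in univ ×ˢ G, ‖g z‖ₑ ^ p * ‖u z.1‖ₑ) ^ (1 / p)
  have hW : ∫⁻ x, ‖u x‖ₑ ≤ ENNReal.ofReal (A * (b * δ ^ (1 - s))) := by
    have h1 : ∀ x, ‖u x‖ₑ ≤ T.indicator (fun _ => ENNReal.ofReal A) x := fun x => by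
      by_cases hx : x ∈ T
      · rw [indicator_of_mem hx, Real.enorm_eq_ofReal_abs]
        exact ENNReal.ofReal_le_ofReal (huA x)
      · have : u x = 0 := by
          by_contra hne
          exact hx (huT hne)
        simp [this]
    refine (lintegral_mono h1).trans ?_
    rw [lintegral_indicator_const hT, ENNReal.ofReal_mul hA]
    gcongr
  obtain ⟨γ, hγ, hGγ⟩ : ∃ γ : ℝ, 0 < γ ∧ volume G = ENNReal.ofReal γ := by
    refine ⟨(volume G).toReal, ENNReal.toReal_pos ?_ hG, (ENNReal.ofReal_toReal hG).symm⟩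
    exact ((ENNReal.ofReal_pos.2 (by positivity)).trans_le hGc).ne'
  rw [hGγ] at hGc ⊢
  have hcγ : c * δ ^ ((1 - s) * (p - 1)) ≤ γ := (ENNReal.ofReal_le_ofReal_iff hγ.le).1 hGc
  have key : (A * (b * δ ^ (1 - s)) * γ) ^ (1 - 1 / p)
      ≤ c ^ (-(1 / p)) * (A * b) ^ (1 - 1 / p) * γ := by
    have h1 : δ ^ ((1 - s) * (1 - 1 / p)) ≤ c ^ (-(1 / p)) * γ ^ (1 / p) := by
      have h2 := Real.rpow_le_rpow (by positivity) hcγ (by positivity : 0 ≤ 1 / p)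
      rw [Real.mul_rpow hc.le (by positivity), ← Real.rpow_mul hδ.le] at h2
      have h3 : (1 - s) * (p - 1) * (1 / p) = (1 - s) * (1 - 1 / p) := by field_simp
      rw [h3] at h2
      have h4 : c ^ (-(1 / p)) * c ^ (1 / p) = 1 := by
        rw [← Real.rpow_add hc, neg_add_cancel, Real.rpow_zero]
      calc δ ^ ((1 - s) * (1 - 1 / p))
          = c ^ (-(1 / p)) * (c ^ (1 / p) * δ ^ ((1 - s) * (1 - 1 / p))) := by
            rw [← mul_assoc, h4, one_mul]
        _ ≤ _ := by gcongr
    have h5 : γ ^ (1 / p) * γ ^ (1 - 1 / p) = γ := by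
      rw [← Real.rpow_add hγ, add_sub_cancel, Real.rpow_one]
    calc (A * (b * δ ^ (1 - s)) * γ) ^ (1 - 1 / p)
        = (A * b) ^ (1 - 1 / p) * δ ^ ((1 - s) * (1 - 1 / p)) * γ ^ (1 - 1 / p) := by
          rw [← mul_assoc, Real.mul_rpow (by positivity) hγ.le,
            Real.mul_rpow (by positivity) (by positivity), ← Real.rpow_mul hδ.le]
      _ ≤ (A * b) ^ (1 - 1 / p) * (c ^ (-(1 / p)) * γ ^ (1 / p)) * γ ^ (1 - 1 / p) := by gcongr
      _ = c ^ (-(1 / p)) * (A * b) ^ (1 - 1 / p) * (γ ^ (1 / p) * γ ^ (1 - 1 / p)) := by ring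
      _ = _ := by rw [h5]
  calc a * ((∫⁻ x, ‖u x‖ₑ) * ENNReal.ofReal γ) ^ (1 - 1 / p)
      ≤ a * (ENNReal.ofReal (A * (b * δ ^ (1 - s))) * ENNReal.ofReal γ) ^ (1 - 1 / p) := by gcongr
    _ = a * ENNReal.ofReal ((A * (b * δ ^ (1 - s)) * γ) ^ (1 - 1 / p)) := by
        rw [← ENNReal.ofReal_mul (by positivity), ENNReal.ofReal_rpow_of_nonneg (by positivity) he]
    _ ≤ a * ENNReal.ofReal (c ^ (-(1 / p)) * (A * b) ^ (1 - 1 / p) * γ) := by gcongr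
    _ = _ := by
        rw [ENNReal.ofReal_mul (by positivity), ENNReal.ofReal_mul (by positivity),
          ENNReal.ofReal_rpow_of_nonneg (by positivity) he]
        ring

theorem sum_enorm_le_ofReal {u : ℕ → ℝ} {I : Finset ℕ} {A : ℝ} (h : ∑ m ∈ I, |u m| ≤ A) :
    ∑ m ∈ I, ‖u m‖ₑ ≤ ENNReal.ofReal A := by
  simp only [Real.enorm_eq_ofReal_abs]
  rw [← ENNReal.ofReal_sum_of_nonneg fun _ _ => abs_nonneg _]
  exact ENNReal.ofReal_le_ofReal h

/-- Summing the horizontal terms over all scales by the discrete Hölder inequality. -/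
theorem sum_horizontal_le {g : ℝ × ℝ → ℝ} (hg : AEStronglyMeasurable g) {p : ℝ} (hp : 1 < p)
    {I : Finset ℕ} {u : ℕ → ℝ → ℝ} (hu : ∀ m, Continuous (u m)) {A : ℝ} (hA : 0 ≤ A)
    (huA : ∀ x, ∑ m ∈ I, |u m x| ≤ A) {b : ℕ → ℝ} (hb : ∀ m, 0 ≤ b m) (hbA : ∑ m ∈ I, b m ≤ A)
    {G : ℕ → Set ℝ} {V : Set ℝ} (hG : ∀ m ∈ I, G m ⊆ V) :
    ∑ m ∈ I, (∫⁻ z in univ ×ˢ G m, ‖g z‖ₑ ^ p * ‖u m z.1‖ₑ) ^ (1 / p) *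
        ENNReal.ofReal (A * b m) ^ (1 - 1 / p) ≤
      (ENNReal.ofReal A * ∫⁻ z in univ ×ˢ V, ‖g z‖ₑ ^ p) ^ (1 / p) *
        ENNReal.ofReal (A * A) ^ (1 - 1 / p) := by
  have hp0 : 0 < p := by linarith
  have hpq : p.HolderConjugate p.conjExponent := .conjExponent hp
  have hq : 1 / p.conjExponent = 1 - 1 / p := by
    rw [one_div, one_div, ← hpq.inv_add_inv_eq_one]
    ring
  have hq0 : 0 < p.conjExponent := hpq.symm.pos
  rw [← hq]
  refine (ENNReal.inner_le_Lp_mul_Lq I _ _ hpq).trans ?_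
  simp only [← ENNReal.rpow_mul, one_div_mul_cancel hp0.ne', one_div_mul_cancel hq0.ne',
    ENNReal.rpow_one]
  gcongr
  · have hm : ∀ m, AEMeasurable (fun z : ℝ × ℝ => ‖g z‖ₑ ^ p * ‖u m z.1‖ₑ)
        (volume.restrict (univ ×ˢ V)) := fun m =>
      ((hg.enorm.pow_const p).mul
        (((hu m).comp continuous_fst).measurable.enorm).aemeasurable).restrict
    calc ∑ m ∈ I, ∫⁻ z in univ ×ˢ G m, ‖g z‖ₑ ^ p * ‖u m z.1‖ₑ
        ≤ ∑ m ∈ I, ∫⁻ z in univ ×ˢ V, ‖g z‖ₑ ^ p * ‖u m z.1‖ₑ :=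
          Finset.sum_le_sum fun m hmI => lintegral_mono_set (prod_mono_right (hG m hmI))
      _ = ∫⁻ z in univ ×ˢ V, ‖g z‖ₑ ^ p * ∑ m ∈ I, ‖u m z.1‖ₑ := by
          rw [← lintegral_finsetSum' _ fun m _ => hm m]
          simp only [Finset.mul_sum]
      _ ≤ ∫⁻ z in univ ×ˢ V, ENNReal.ofReal A * ‖g z‖ₑ ^ p := by
          refine lintegral_mono fun z => ?_
          rw [mul_comm]
          gcongr
          exact sum_enorm_le_ofReal (huA _)
      _ = _ := lintegral_const_mul' _ _ ENNReal.ofReal_ne_top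
  · rw [← ENNReal.ofReal_sum_of_nonneg fun m _ => mul_nonneg hA (hb m), ← Finset.mul_sum]
    gcongr

/-- The pairing of `F ∈ L^p(ℝ)` with a sum of functions supported in sets of small total measure. -/
theorem sum_enorm_integral_mul_le {F : ℝ → ℝ} {p : ℝ} (hp : 1 ≤ p) (hF : AEStronglyMeasurable F)
    {I : Finset ℕ} {u : ℕ → ℝ → ℝ} (hu : ∀ m, Continuous (u m)) {A : ℝ}
    (huA : ∀ x, ∑ m ∈ I, |u m x| ≤ A) {T : ℕ → Set ℝ} (hT : ∀ m, MeasurableSet (T m))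
    (huT : ∀ m, Function.support (u m) ⊆ T m) {B : ℝ≥0∞} (hTB : ∑ m ∈ I, volume (T m) ≤ B) :
    ∑ m ∈ I, ‖∫ x, F x * u m x‖ₑ ≤
      ENNReal.ofReal A * (eLpNorm F (ENNReal.ofReal p) volume * B ^ (1 - 1 / p)) := by
  have he : 0 ≤ 1 - 1 / p := by
    rw [sub_nonneg, div_le_one (by linarith)]; exact hp
  have hU : MeasurableSet (⋃ m ∈ I, T m) := Finset.measurableSet_biUnion _ fun m _ => hT m
  calc ∑ m ∈ I, ‖∫ x, F x * u m x‖ₑ ≤ ∑ m ∈ I, ∫⁻ x, ‖F x‖ₑ * ‖u m x‖ₑ := by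
        refine Finset.sum_le_sum fun m _ => (enorm_integral_le_lintegral_enorm _).trans_eq ?_
        simp only [enorm_mul]
    _ = ∫⁻ x, ∑ m ∈ I, ‖F x‖ₑ * ‖u m x‖ₑ :=
        (lintegral_finsetSum' _ fun m _ =>
          hF.enorm.mul (hu m).measurable.enorm.aemeasurable).symm
    _ ≤ ∫⁻ x in ⋃ m ∈ I, T m, ENNReal.ofReal A * ‖F x‖ₑ := by
        rw [← lintegral_indicator hU]
        refine lintegral_mono fun x => ?_
        by_cases hx : x ∈ ⋃ m ∈ I, T m
        · rw [indicator_of_mem hx, ← Finset.mul_sum, mul_comm]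
          gcongr
          exact sum_enorm_le_ofReal (huA _)
        · rw [indicator_of_notMem hx]
          refine (Finset.sum_eq_zero fun m hm => ?_).le
          have : u m x = 0 := by
            by_contra hne
            exact hx (mem_biUnion hm (huT m hne))
          simp [this]
    _ = ENNReal.ofReal A * ∫⁻ x in ⋃ m ∈ I, T m, ‖F x‖ₑ :=
        lintegral_const_mul' _ _ ENNReal.ofReal_ne_top
    _ ≤ _ := by
        gcongr
        refine (setLIntegral_enorm_le_eLpNorm_mul hp hF _).trans ?_
        gcongr
        exact (measure_biUnion_finset_le I T).trans hTB

/-- The `L^p` mass of a function on a horizontal strip tends to zero with the height of the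
strip. -/
theorem tendsto_setLIntegral_strip {g : ℝ × ℝ → ℝ} {p : ℝ} (hp : 0 < p)
    (hg : MemLp g (ENNReal.ofReal p)) (y : ℝ) :
    Filter.Tendsto (fun k : ℕ => ∫⁻ z in univ ×ˢ Metric.ball y ((1 / 2) ^ k), ‖g z‖ₑ ^ p)
      Filter.atTop (nhds 0) := by
  have hm : AEMeasurable fun z => ‖g z‖ₑ ^ p := hg.1.enorm.pow_const p
  simp only [← setLIntegral_univ_prod hm]
  refine tendsto_setLIntegral_zero ?_ ?_
  · have h1 := setLIntegral_univ_prod hm univ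
    rw [univ_prod_univ, Measure.restrict_univ, Measure.restrict_univ] at h1
    rw [h1]
    have h2 := lintegral_rpow_enorm_lt_top_of_eLpNorm_lt_top (by simpa using hp) (by simp) hg.2
    rw [ENNReal.toReal_ofReal hp.le] at h2
    exact h2.ne
  · simp only [Function.comp_def, Real.volume_ball]
    have h1 : Filter.Tendsto (fun k : ℕ => 2 * (1 / 2 : ℝ) ^ k) Filter.atTop (nhds (2 * 0)) :=
      (tendsto_pow_atTop_nhds_zero_of_lt_one (by norm_num) (by norm_num)).const_mul 2
    rw [mul_zero] at h1
    simpa using ENNReal.tendsto_ofReal h1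

/-! ### Slices through the product set -/

theorem slicePair_eq_add_sum {f : ℝ × ℝ → ℝ} {y : ℝ} (hf : LocallyIntegrable fun x => f (x, y))
    {a r : ℝ → ℝ} {v : ℕ → ℝ → ℝ} {I : Finset ℕ} (hr : Continuous r) (hrc : HasCompactSupport r)
    (hv : ∀ m, Continuous (v m)) (hvc : ∀ m, HasCompactSupport (v m))
    (h : ∀ x, a x = r x + ∑ m ∈ I, v m x) :
    slicePair f a y = slicePair f r y + ∑ m ∈ I, slicePair f (v m) y := by
  have i1 : Integrable fun x => f (x, y) * r x :=
    hf.integrable_smul_right_of_hasCompactSupport hr hrc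
  have i2 : ∀ m, Integrable fun x => f (x, y) * v m x := fun m =>
    hf.integrable_smul_right_of_hasCompactSupport (hv m) (hvc m)
  unfold slicePair
  rw [← integral_finsetSum I fun m _ => i2 m,
    ← integral_add i1 (integrable_finsetSum I fun m _ => i2 m)]
  simp only [h, mul_add, Finset.mul_sum]

/-- On almost every horizontal line at a height in `F`, the slice of `g` is the derivative of the
slice of `f` as far as pairing with a fixed test function is concerned. Near `C` the test function
is decomposed into pieces of scales `2⁻ᵐ`, `m ≥ k`; the total contribution of the pieces is at most
the sum of a vertical, a horizontal and a remainder term, all of which tend to zero as `k → ∞`. -/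
theorem ae_slicePair_deriv_add_slicePair_eq_zero_of_mem {p s : ℝ} (hp : 1 < p) (hs0 : 0 ≤ s)
    (hs : s < (p - 2) / (p - 1)) {C F : Set ℝ} (hC : IsClosed C)
    (hCs : Measure.hausdorffMeasure s C < ⊤) (hF : IsClosed F)
    (hdens : ∀ᵐ y : ℝ, y ∈ F → ∃ r₀ > (0 : ℝ), ∃ c > (0 : ℝ), ∀ r : ℝ, 0 < r → r < r₀ →
      ENNReal.ofReal (c * r ^ ((1 - s) * (p - 1))) ≤ volume (Metric.ball y r \ F))
    {f g h : ℝ × ℝ → ℝ} (hf : MemLp f (ENNReal.ofReal p)) (hg : MemLp g (ENNReal.ofReal p))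
    (hh : MemLp h (ENNReal.ofReal p)) (hwx : HasWeakDirDeriv (C ×ˢ F)ᶜ (1, 0) f g)
    (hwy : HasWeakDirDeriv univ (0, 1) f h) {ψ : ℝ → ℝ} (hψ : ContDiff ℝ ∞ ψ)
    (hψc : HasCompactSupport ψ) :
    ∀ᵐ y, y ∈ F → slicePair f (deriv ψ) y + slicePair g ψ y = 0 := by
  have hp0 : 0 < p := by linarith
  have hP1 : 1 ≤ ENNReal.ofReal p := by rw [ENNReal.one_le_ofReal]; exact hp.le
  have hP0 : ENNReal.ofReal p ≠ 0 := (zero_lt_one.trans_le hP1).ne'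
  have hs1 : s < 1 := hs.trans_le (by rw [div_le_one (by linarith)]; linarith)
  have he : 0 < 1 - 1 / p := by
    rw [sub_pos, div_lt_one hp0]; exact hp
  -- `κ > 0` restates the upper bound on `s`; it makes the vertical terms summable.
  set κ : ℝ := (2 - s) * (1 - 1 / p) - 1 with hκdef
  have hκ : 0 < κ := by
    rw [lt_div_iff₀ (by linarith)] at hs
    have : κ = (p - 2 - s * (p - 1)) / p := by rw [hκdef]; field_simp; ring
    rw [this]
    exact div_pos (by linarith) hp0
  set ρ : ℝ := (1 / 2) ^ κ
  have hρ0 : 0 ≤ ρ := by positivity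
  have hρ1 : ρ < 1 := Real.rpow_lt_one (by norm_num) (by norm_num) hκ
  have lf := hf.locallyIntegrable hP1
  have lg := hg.locallyIntegrable hP1
  have lh := hh.locallyIntegrable hP1
  obtain ⟨A, hA, hdec⟩ := exists_multiscale_decomposition hC hs0 hCs hψ hψc
  choose N u T b hu huc huT hT hb hTb hud huA hbA hdisj using hdec
  set rest : ℕ → ℝ → ℝ := fun k x => ψ x - ∑ m ∈ Finset.Ico k (N k), u k m x
  have hrest : ∀ k, ContDiff ℝ ∞ (rest k) := fun k =>
    hψ.sub (ContDiff.sum fun m _ => hu k m)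
  have hrestc : ∀ k, HasCompactSupport (rest k) := fun k => by
    refine hψc.sub ?_
    have : (fun x => ∑ m ∈ Finset.Ico k (N k), u k m x) = ∑ m ∈ Finset.Ico k (N k), u k m := by
      ext x; simp
    rw [this]
    exact Finset.sum_induction _ HasCompactSupport (fun _ _ ha hb => ha.add hb)
      HasCompactSupport.zero fun m _ => huc k m
  have huS : ∀ k m, Function.support (u k m) ⊆ T k m := fun k m =>
    (subset_tsupport _).trans (huT k m)
  have hu' : ∀ k m, Continuous (deriv (u k m)) := fun k m => (hu k m).continuous_deriv (by simp)
  -- The decompositions do not depend on `y`, so only countably many exceptional null sets occur.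
  have h1 : ∀ᵐ y, ∀ k m, ∀ δ : ℝ,
      ‖slicePair f (deriv (u k m)) y‖ₑ * volume (Metric.ball y δ \ F) ≤
      (∫⁻ t in Metric.ball y δ, ‖slicePair h (deriv (u k m)) t‖ₑ) *
        volume (Metric.ball y δ \ F) + ∫⁻ t in Metric.ball y δ \ F, ‖slicePair g (u k m) t‖ₑ := by
    rw [ae_all_iff]; intro k
    rw [ae_all_iff]; intro m
    exact ae_enorm_slicePair_deriv_mul_le lf lg lh hF hwx hwy (hu k m) (huc k m)
  have h2 : ∀ᵐ y, ∀ k, slicePair f (deriv (rest k)) y + slicePair g (rest k) y = 0 := by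
    rw [ae_all_iff]; intro k
    have := ae_slicePair_deriv_add_slicePair_eq_zero lf lg hwx (hrest k) (hrestc k) isOpen_univ
      fun z hz hzE => disjoint_left.1 (hdisj k) hz.1 hzE.1
    filter_upwards [this] with y hy using hy (mem_univ y)
  filter_upwards [h1, h2, hdens, hf.ae_memLp_slice hP0 (by simp), hg.ae_memLp_slice hP0 (by simp)]
    with y h1y h2y h3y hfy hgy hyF
  obtain ⟨r₀, hr₀, c, hc, hgap⟩ := h3y hyF
  have lfy := hfy.locallyIntegrable hP1
  have lgy := hgy.locallyIntegrable hP1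
  -- The vertical, the horizontal and the remainder term.
  set Φ : ℕ → ℝ≥0∞ := fun k =>
    eLpNorm h (ENNReal.ofReal p) volume *
      ENNReal.ofReal (A * (2 * A) ^ (1 - 1 / p) * (ρ ^ k / (1 - ρ))) +
    ENNReal.ofReal (c ^ (-(1 / p))) *
      ((ENNReal.ofReal A * ∫⁻ z in univ ×ˢ Metric.ball y ((1 / 2) ^ k), ‖g z‖ₑ ^ p) ^ (1 / p) *
        ENNReal.ofReal (A * A) ^ (1 - 1 / p)) +
    ENNReal.ofReal A * (eLpNorm (fun x => g (x, y)) (ENNReal.ofReal p) volume *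
      ENNReal.ofReal (A * ((1 / 2 : ℝ) ^ k) ^ (1 - s)) ^ (1 - 1 / p))
  have hbound : ∀ k : ℕ, (1 / 2 : ℝ) ^ k < r₀ →
      ‖slicePair f (deriv ψ) y + slicePair g ψ y‖ₑ ≤ Φ k := by
    intro k hk
    set I := Finset.Ico k (N k)
    have hδk : ∀ m ∈ I, (1 / 2 : ℝ) ^ m ≤ (1 / 2) ^ k := fun m hm =>
      pow_le_pow_of_le_one (by norm_num) (by norm_num) (Finset.mem_Ico.1 hm).1
    have hbm : ∀ m ∈ I, b k m ≤ A := fun m hm =>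
      (Finset.single_le_sum (fun j _ => hb k j) hm).trans (hbA k)
    have hum : ∀ m ∈ I, ∀ x, |u k m x| ≤ A := fun m hm x =>
      (Finset.single_le_sum (f := fun j => |u k j x|) (fun j _ => abs_nonneg _) hm).trans
        (huA k x)
    have hderψ : ∀ x, deriv ψ x = deriv (rest k) x + ∑ m ∈ I, deriv (u k m) x := fun x => by
      have hd1 := ((hψ.differentiable (by simp)) x).hasDerivAt
      have hd2 : HasDerivAt (fun x => ∑ m ∈ I, u k m x) (∑ m ∈ I, deriv (u k m) x) x :=
        HasDerivAt.fun_sum fun m _ => (((hu k m).differentiable (by simp)) x).hasDerivAt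
      rw [(hd1.fun_sub hd2).deriv, sub_add_cancel]
    have e1 := slicePair_eq_add_sum lfy (a := deriv ψ) (I := I)
      ((hrest k).continuous_deriv (by simp)) (hrestc k).deriv (hu' k) (fun m => (huc k m).deriv)
      hderψ
    have e2 := slicePair_eq_add_sum lgy (a := ψ) (I := I) (hrest k).continuous (hrestc k)
      (fun m => (hu k m).continuous) (huc k) fun x => (sub_add_cancel _ _).symm
    have e3 : slicePair f (deriv ψ) y + slicePair g ψ y
        = ∑ m ∈ I, slicePair f (deriv (u k m)) y + ∑ m ∈ I, slicePair g (u k m) y := by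
      rw [e1, e2]
      linear_combination h2y k
    have single : ∀ m ∈ I, ‖slicePair f (deriv (u k m)) y‖ₑ ≤
        eLpNorm h (ENNReal.ofReal p) volume *
          ENNReal.ofReal (A * (2 * A) ^ (1 - 1 / p) * ρ ^ m) +
        ENNReal.ofReal (c ^ (-(1 / p))) *
          ((∫⁻ z in univ ×ˢ (Metric.ball y ((1 / 2) ^ m) \ F), ‖g z‖ₑ ^ p * ‖u k m z.1‖ₑ)
            ^ (1 / p) * ENNReal.ofReal (A * b k m) ^ (1 - 1 / p)) := by
      intro m hm
      have hδ : (0 : ℝ) < (1 / 2) ^ m := by positivity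
      have hGc := hgap _ hδ ((hδk m hm).trans_lt hk)
      have hG0 : volume (Metric.ball y ((1 / 2) ^ m) \ F) ≠ 0 :=
        ((ENNReal.ofReal_pos.2 (by positivity)).trans_le hGc).ne'
      have hGt : volume (Metric.ball y ((1 / 2) ^ m) \ F) ≠ ⊤ :=
        measure_ne_top_of_subset sdiff_subset measure_ball_lt_top.ne
      have hv := vertical_term_le hh.1 hp.le (hu' k m) (hT k m)
        (support_deriv_subset.trans (huT k m)) hA (hb k m) (hbm m hm) (hud k m) (hTb k m) y
      have hhor := horizontal_term_le hg.1 hp (hu k m).continuous (hT k m) (huS k m) hA (hb k m)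
        hc hδ (hum m hm) (hTb k m) hGt hGc
      -- Divide the estimate at scale `2⁻ᵐ` by the measure of the gap set.
      rw [← ENNReal.mul_le_mul_iff_left hG0 hGt, add_mul]
      exact (h1y k m _).trans (add_le_add (by gcongr) hhor)
    have hTsum : ∑ m ∈ I, volume (T k m) ≤ ENNReal.ofReal (A * ((1 / 2 : ℝ) ^ k) ^ (1 - s)) := by
      refine (Finset.sum_le_sum fun m _ => hTb k m).trans ?_
      rw [← ENNReal.ofReal_sum_of_nonneg fun m _ => mul_nonneg (hb k m) (by positivity)]
      apply ENNReal.ofReal_le_ofReal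
      calc _ ≤ ∑ m ∈ I, b k m * ((1 / 2 : ℝ) ^ k) ^ (1 - s) :=
            Finset.sum_le_sum fun m hm => mul_le_mul_of_nonneg_left
              (Real.rpow_le_rpow (by positivity) (hδk m hm) (by linarith)) (hb k m)
        _ ≤ _ := by
            rw [← Finset.sum_mul]
            exact mul_le_mul_of_nonneg_right (hbA k) (by positivity)
    rw [e3]
    refine (enorm_add_le _ _).trans (add_le_add ?_ ?_)
    · refine (enorm_sum_le _ _).trans ((Finset.sum_le_sum single).trans ?_)
      rw [Finset.sum_add_distrib, ← Finset.mul_sum, ← Finset.mul_sum]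
      gcongr
      · rw [← ENNReal.ofReal_sum_of_nonneg fun m _ => by positivity, ← Finset.mul_sum]
        apply ENNReal.ofReal_le_ofReal
        gcongr
        exact geom_sum_Ico_le_of_lt_one hρ0 hρ1
      · exact sum_horizontal_le hg.1 hp (fun m => (hu k m).continuous) hA (huA k) (hb k) (hbA k)
          fun m hm => sdiff_subset.trans (Metric.ball_subset_ball (hδk m hm))
    · exact (enorm_sum_le _ _).trans (sum_enorm_integral_mul_le hp.le hgy.1
        (fun m => (hu k m).continuous) (huA k) (hT k) (huS k) hTsum)
  have hΦ : Filter.Tendsto Φ Filter.atTop (nhds 0) := by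
    have t1 : Filter.Tendsto
        (fun k : ℕ => ENNReal.ofReal (A * (2 * A) ^ (1 - 1 / p) * (ρ ^ k / (1 - ρ))))
        Filter.atTop (nhds 0) := by
      have := ((tendsto_pow_atTop_nhds_zero_of_lt_one hρ0 hρ1).div_const (1 - ρ)).const_mul
        (A * (2 * A) ^ (1 - 1 / p))
      rw [zero_div, mul_zero] at this
      simpa using ENNReal.tendsto_ofReal this
    have t2 := (ENNReal.Tendsto.const_mul (a := ENNReal.ofReal A)
      (tendsto_setLIntegral_strip hp0 hg y) (Or.inr ENNReal.ofReal_ne_top)).ennrpow_const (1 / p)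
    rw [mul_zero, ENNReal.zero_rpow_of_pos (by positivity)] at t2
    have t3 : Filter.Tendsto
        (fun k : ℕ => ENNReal.ofReal (A * ((1 / 2 : ℝ) ^ k) ^ (1 - s)) ^ (1 - 1 / p))
        Filter.atTop (nhds 0) := by
      have := ((tendsto_pow_atTop_nhds_zero_of_lt_one (r := (1 / 2 : ℝ)) (by norm_num)
        (by norm_num)).rpow_const (p := 1 - s) (Or.inr (by linarith))).const_mul A
      rw [Real.zero_rpow (by linarith), mul_zero] at this
      have := (ENNReal.tendsto_ofReal this).ennrpow_const (1 - 1 / p)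
      rwa [ENNReal.ofReal_zero, ENNReal.zero_rpow_of_pos he] at this
    have hE : ENNReal.ofReal (A * A) ^ (1 - 1 / p) ≠ ⊤ :=
      ENNReal.rpow_ne_top_of_nonneg he.le ENNReal.ofReal_ne_top
    have t4 := ((ENNReal.Tendsto.const_mul t1 (Or.inr hh.2.ne)).add
      (ENNReal.Tendsto.const_mul (ENNReal.Tendsto.mul_const t2 (Or.inr hE))
        (Or.inr (ENNReal.ofReal_ne_top (r := c ^ (-(1 / p))))))).add
      (ENNReal.Tendsto.const_mul (ENNReal.Tendsto.const_mul t3 (Or.inr hgy.2.ne))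
        (Or.inr (ENNReal.ofReal_ne_top (r := A))))
    simpa only [mul_zero, zero_mul, add_zero] using t4
  have hev : ∀ᶠ k : ℕ in Filter.atTop, (1 / 2 : ℝ) ^ k < r₀ :=
    (tendsto_pow_atTop_nhds_zero_of_lt_one (by norm_num) (by norm_num)).eventually_lt_const hr₀
  have hle := ge_of_tendsto hΦ (hev.mono hbound)
  rwa [nonpos_iff_eq_zero, enorm_eq_zero] at hle

/-! ### Removability -/

/-- A set of finite Hausdorff measure of negative dimension is empty, as a point has infinite
measure. -/
theorem eq_empty_of_hausdorffMeasure_lt_top_of_neg {s : ℝ} (hs : s < 0) {C : Set ℝ}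
    (hC : Measure.hausdorffMeasure s C < ⊤) : C = ∅ := by
  by_contra hne
  obtain ⟨x, hx⟩ := nonempty_iff_ne_empty.2 hne
  have h1 : (Measure.hausdorffMeasure 0 : Measure ℝ) {x} = 0 := by
    rcases Measure.hausdorffMeasure_zero_or_top hs ({x} : Set ℝ) with h | h
    · exact h
    · exact absurd ((measure_mono (singleton_subset_iff.2 hx)).trans_lt hC) (by simp [h])
  simp [Measure.hausdorffMeasure_zero_singleton] at h1

theorem sobolevSpace_univ_subset_of_null (p : ℝ≥0∞) {E : Set (ℝ × ℝ)} (hE : volume E = 0) :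
    sobolevSpace p univ ⊆ sobolevSpace p Eᶜ := by
  have hres : (volume : Measure (ℝ × ℝ)).restrict Eᶜ = volume :=
    Measure.restrict_eq_self_of_ae_mem (compl_mem_ae_iff.2 hE)
  have hmono : ∀ v f g, HasWeakDirDeriv univ v f g → HasWeakDirDeriv Eᶜ v f g :=
    fun v f g h φ hφ hφc _ => by
      have := h φ hφ hφc (subset_univ _)
      simpa only [Measure.restrict_univ, hres] using this
  rintro f ⟨hf, ⟨g, hg, hwg⟩, h, hh, hwh⟩
  rw [Measure.restrict_univ] at hf hg hh
  simp only [sobolevSpace, hres]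
  exact ⟨hf, ⟨g, hg, hmono _ _ _ hwg⟩, h, hh, hmono _ _ _ hwh⟩

theorem mainTheorem2 (p s : ℝ) (hp : 2 ≤ p) (hs : s < (p - 2) / (p - 1))
    (C F : Set ℝ) (hC : IsClosed C) (hCs : Measure.hausdorffMeasure s C < ⊤)
    (hF : IsClosed F)
    (hdens : ∀ᵐ y ∂(Measure.hausdorffMeasure 1 : Measure ℝ), y ∈ F →
      ∃ r₀ > (0 : ℝ), ∃ c > (0 : ℝ), ∀ r : ℝ, 0 < r → r < r₀ →
        ENNReal.ofReal (c * r ^ ((1 - s) * (p - 1))) ≤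
          Measure.hausdorffMeasure 1 (Metric.ball y r \ F)) :
    IsSobolevRemovable (ENNReal.ofReal p) (C ×ˢ F) := by
  rcases lt_or_ge s 0 with hs0 | hs0
  · rw [eq_empty_of_hausdorffMeasure_lt_top_of_neg hs0 hCs, empty_prod]
    exact ⟨measure_empty, by rw [compl_empty]⟩
  rw [hausdorffMeasure_real] at hdens
  have hs1 : s < 1 := hs.trans_le (by rw [div_le_one (by linarith)]; linarith)
  have hC0 : volume C = 0 := by
    rw [← hausdorffMeasure_real]
    exact (Measure.hausdorffMeasure_zero_or_top hs1 C).resolve_right hCs.ne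
  have hE0 : volume (C ×ˢ F) = 0 := by
    rw [Measure.volume_eq_prod, Measure.prod_prod, hC0, zero_mul]
  refine ⟨hE0, Subset.antisymm ?_ (sobolevSpace_univ_subset_of_null _ hE0)⟩
  have hres : (volume : Measure (ℝ × ℝ)).restrict (C ×ˢ F)ᶜ = volume :=
    Measure.restrict_eq_self_of_ae_mem (compl_mem_ae_iff.2 hE0)
  have hP1 : 1 ≤ ENNReal.ofReal p := by rw [ENNReal.one_le_ofReal]; linarith
  have hP0 : ENNReal.ofReal p ≠ 0 := (zero_lt_one.trans_le hP1).ne'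
  rintro f ⟨hf, ⟨g, hg, hwg⟩, h, hh, hwh⟩
  rw [hres] at hf hg hh
  have lf := hf.locallyIntegrable hP1
  have lg := hg.locallyIntegrable hP1
  have hwh' := hwh.vertical_univ_of_null lf (hh.locallyIntegrable hP1) hC hC0 hE0
  refine ⟨by rwa [Measure.restrict_univ], ⟨g, by rwa [Measure.restrict_univ], ?_⟩,
    h, by rwa [Measure.restrict_univ], hwh'⟩
  refine hasWeakDirDeriv_horizontal_of_slicePair lf lg
    ((hf.ae_memLp_slice hP0 (by simp)).mono fun y hy => hy.locallyIntegrable hP1)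
    ((hg.ae_memLp_slice hP0 (by simp)).mono fun y hy => hy.locallyIntegrable hP1)
    fun ψ hψ hψc => ?_
  filter_upwards [ae_slicePair_deriv_add_slicePair_eq_zero_of_mem (by linarith) hs0 hs hC hCs hF
      hdens hf hg hh hwg hwh' hψ hψc,
    ae_slicePair_deriv_add_slicePair_eq_zero lf lg hwg hψ hψc hF.isOpen_compl
      fun z hz hzE => hz.2 hzE.2] with y hy1 hy2
  by_cases hyF : y ∈ F
  · exact hy1 hyF
  · exact hy2 hyF
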